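/- Let $p>q\ge 2$ be integers and, for $c\in\mathbb C$, let $\mathbf f_c$ be the correspondence on $\mathbb C$ that relates $z$ to every $w$ with $(w-c)^q=z^p$ (such a $w$ is called an image of $z$). A forward orbit is a sequence $(z_i)_{i\ge 0}$ in which each $z_{i+1}$ is an image of $z_i$. If $w$ is an image of $z\ne 0$, let $g_{z,w}$ be the local univalent branch of $\mathbf f_c$ with $g_{z,w}(z)=w$; then $g_{z,w}'(z)=p(w-c)/(qz)$. A finite orbit $(z_0,\dots,z_n)$, $n\ge 1$, avoiding $0$, with $z_n=z_0$ and $z_i\neq z_0$ for $0<i<n$, is a repelling cycle if $\prod_{i<n}|g_{z_i,z_{i+1}}'(z_i)|>1$. The Julia set $J(\mathbf f_c)$ is the closure of the union of all repelling cycles. Let $X_c\subset\mathbb C^{\mathbb N}$ be the space of all forward orbits contained in $J(\mathbf f_c)$, with the product topology and the left shift $\sigma$, let $\varphi_c((z_i)_i)=-\log|g_{z_0,z_1}'(z_0)|$, and let $P(t\varphi_c)$ be the topological pressure of $t\varphi_c$ with respect to $\sigma$ on $X_c$. When the function $t\mapsto P(t\varphi_c)$ has exactly one zero on $[0,\infty)$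 and this zero is positive, it is called the Bowen parameter $t_c$. A parameter $a$ is a simple centre if precisely one forward orbit of $0$ under $\mathbf f_a$ is periodic and all other forward orbits of $0$ diverge to infinity. (i) Every simple centre $a$ has a neighbourhood such that for every $c$ in it the Bowen parameter $t_c$ exists and $\dim_H J(\mathbf f_c)\le t_c$. (ii) If every forward orbit of $0$ under $\mathbf f_c$ diverges to infinity, or if no forward orbit of $0$ under $\mathbf f_c$ is bounded (that is, $c\notin\mathcal M_{\beta,0}$, $\beta=p/q$), then the Bowen parameter $t_c$ exists and $\dim_H J(\mathbf f_c)\le t_c$. -/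

import Mathlib

open Filter Topology Uniformity

noncomputable section

/-- Topological pressure of the potential `φ` for the map `T` on the (invariant, compact) set `F`,
defined through separated sets:
`P(φ) = sup_U limsup_n (1/n) log sup_E ∑_{x ∈ E} exp (S_n φ (x))`,
where `U` runs over the entourages, `E` over the finite `(U, n)`-separated subsets of `F`, and
`S_n φ` is the Birkhoff sum. -/
def topologicalPressure {X : Type*} [UniformSpace X] (T : X → X) (F : Set X) (φ : X → ℝ) :
    EReal :=
  ⨆ U ∈ 𝓤 X, ExpGrowth.expGrowthSup fun n : ℕ ↦
    ⨆ (E : Finset X) (_ : Dynamics.IsDynNetIn T F U n (E : Set X)),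
      ∑ x ∈ E, ENNReal.ofReal (Real.exp (birkhoffSum T φ n x))

/-- The pressure of the zero potential is the topological entropy. -/
theorem topologicalPressure_zero {X : Type*} [UniformSpace X] (T : X → X) (F : Set X) :
    topologicalPressure T F (fun _ ↦ 0) = Dynamics.coverEntropy T F := by
  rw [Dynamics.coverEntropy_eq_iSup_netEntropyEntourage]
  refine iSup_congr fun U ↦ iSup_congr fun _ ↦ ?_
  unfold Dynamics.netEntropyEntourage
  congr 1
  funext n
  simp [birkhoffSum, Dynamics.netMaxcard, ENat.toENNReal_iSup]

namespace Correspondence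

/-- `w` is an image of `z` under the correspondence `𝐟_c : (w - c) ^ q = z ^ p`. -/
def IsImage (p q : ℕ) (c z w : ℂ) : Prop := (w - c) ^ q = z ^ p

/-- An infinite forward orbit `z 0 ↦ z 1 ↦ z 2 ↦ ⋯`. -/
def IsOrbit (p q : ℕ) (c : ℂ) (z : ℕ → ℂ) : Prop := ∀ i, IsImage p q c (z i) (z (i + 1))

/-- The derivative at `z ≠ 0` of the univalent branch `g` of the correspondence with `g z = w`;
see `hasDerivAt_branch`. -/
def branchDeriv (p q : ℕ) (c z w : ℂ) : ℂ := p * (w - c) / (q * z)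

/-- Every local branch of the correspondence at a point `z ≠ 0` has the derivative
`branchDeriv p q c z (g z)` there. -/
theorem hasDerivAt_branch {p q : ℕ} (hq : q ≠ 0) {c z : ℂ} (hz : z ≠ 0) {g : ℂ → ℂ}
    (hg : DifferentiableAt ℂ g z) (h : ∀ᶠ ζ in 𝓝 z, IsImage p q c ζ (g ζ)) :
    HasDerivAt g (branchDeriv p q c z (g z)) z := by
  have h0 : (g z - c) ^ q = z ^ p := h.self_of_nhds
  have hw : g z - c ≠ 0 := by
    intro hw
    rw [hw, zero_pow hq] at h0
    exact pow_ne_zero p hz h0.symm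
  have h1 := (hg.hasDerivAt.sub_const c).pow q
  have h2 : HasDerivAt (fun ζ ↦ ζ ^ p) (q * (g z - c) ^ (q - 1) * deriv g z) z := by
    refine h1.congr_of_eventuallyEq ?_
    filter_upwards [h] with ζ hζ
    exact hζ.symm
  have h3 := h2.unique (hasDerivAt_pow p z)
  have hq' : (q : ℂ) ≠ 0 := by exact_mod_cast hq
  have h4 : deriv g z = branchDeriv p q c z (g z) := by
    rw [branchDeriv, eq_div_iff (mul_ne_zero hq' hz)]
    have hpow : (g z - c) ^ (q - 1) ≠ 0 := pow_ne_zero _ hw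
    apply mul_left_cancel₀ hpow
    have e1 : (g z - c) ^ (q - 1) * (g z - c) = (g z - c) ^ q := pow_sub_one_mul hq _
    have e2 : (p : ℂ) * z ^ (p - 1) * z = p * z ^ p := by
      rcases Nat.eq_zero_or_pos p with rfl | hp
      · simp
      · rw [mul_assoc, pow_sub_one_mul hp.ne']
    calc (g z - c) ^ (q - 1) * (deriv g z * (q * z))
        = (q * (g z - c) ^ (q - 1) * deriv g z) * z := by ring
      _ = p * z ^ p := by rw [h3, e2]
      _ = (g z - c) ^ (q - 1) * (p * (g z - c)) := by rw [← h0, ← e1]; ring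
  exact h4 ▸ hg.hasDerivAt

/-- `(z 0, …, z n)` is a repelling cycle of period `n`: a finite orbit avoiding `0` that returns to
`z 0` for the first time at time `n`, such that the composition `g` of the branches along the
cycle, whose derivative is the product of the derivatives of the branches, has `|g' (z 0)| > 1`. -/
def IsRepellingCycle (p q : ℕ) (c : ℂ) (n : ℕ) (z : ℕ → ℂ) : Prop :=
  0 < n ∧ (∀ i < n, IsImage p q c (z i) (z (i + 1))) ∧ z n = z 0 ∧
    (∀ i, 0 < i → i < n → z i ≠ z 0) ∧ (∀ i < n, z i ≠ 0) ∧
    1 < ‖∏ i ∈ Finset.range n, branchDeriv p q c (z i) (z (i + 1))‖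

/-- The Julia set `J(𝐟_c)`: the closure of the union of all repelling cycles. -/
def juliaSet (p q : ℕ) (c : ℂ) : Set ℂ :=
  closure {ζ | ∃ n z, IsRepellingCycle p q c n z ∧ ∃ i < n, z i = ζ}

/-- `c` is a simple centre: precisely one forward orbit of the critical point `0` is periodic, and
all the others diverge to infinity. -/
def IsSimpleCentre (p q : ℕ) (c : ℂ) : Prop :=
  ∃ z : ℕ → ℂ, IsOrbit p q c z ∧ z 0 = 0 ∧ (∃ n > 0, Function.Periodic z n) ∧
    ∀ w : ℕ → ℂ, IsOrbit p q c w → w 0 = 0 → w ≠ z → Tendsto w atTop (Bornology.cobounded ℂ)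

/-- The set `M_{β,0}` of the parameters for which `0` has at least one bounded forward orbit. -/
def boundedCriticalLocus (p q : ℕ) : Set ℂ :=
  {c | ∃ z : ℕ → ℂ, IsOrbit p q c z ∧ z 0 = 0 ∧ Bornology.IsBounded (Set.range z)}

/-- The space `X_c` of all forward orbits contained in the Julia set. It is regarded as a subspace
of the product space `ℂ^ℕ`. -/
def orbitSpace (p q : ℕ) (c : ℂ) : Set (ℕ → ℂ) :=
  {z | IsOrbit p q c z ∧ ∀ i, z i ∈ juliaSet p q c}

/-- The left shift on sequences. -/
def shift (z : ℕ → ℂ) : ℕ → ℂ := fun i ↦ z (i + 1)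

/-- The geometric potential `φ_c = -log |g'(z 0)|`, where `g` is the branch with
`g (z 0) = z 1`. -/
def geometricPotential (p q : ℕ) (c : ℂ) (z : ℕ → ℂ) : ℝ :=
  -Real.log ‖branchDeriv p q c (z 0) (z 1)‖

/-- The pressure function `t ↦ P(t φ_c)` of the shift on the orbit space `X_c`. -/
def pressureFunction (p q : ℕ) (c : ℂ) (t : ℝ) : EReal :=
  topologicalPressure shift (orbitSpace p q c) fun z ↦ t * geometricPotential p q c z

/-- `t` is the Bowen parameter `t_c`: it is positive and it is the unique zero of the pressure
function on `[0, ∞)`. -/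
def IsBowenParameter (p q : ℕ) (c : ℂ) (t : ℝ) : Prop :=
  0 < t ∧ ∀ s : ℝ, 0 ≤ s → (pressureFunction p q c s = 0 ↔ s = t)

end Correspondence

end

/-! The whole argument rests on a trapping domain (`IsTrapping`): a bounded open set `U` that
contains the repelling cycles, misses the critical value `c`, and contains the `ε`-neighbourhood of
its own preimage. Since `c` is omitted, holomorphic discs in `U` lift through the inverse
correspondence (`exists_lift`), and each lift has room to be enlarged by the factor `1 + ε / R`
(`exists_enlarge`). Cauchy's estimate bounds all such discs, so the forward branches expand
exponentially (`le_norm_prod_branchDeriv`). This plays the role of a hyperbolic metric.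

Expansion forces the pressure function to decrease at a definite rate, while bounded derivatives
keep it Lipschitz. Its value at `0` is the entropy, which is finite because the shift is expansive
(`exists_expansive`), and at least `log 2` because a backward invariant subset of the Julia set
(`exists_backward_invariant`) offers two uniformly separated preimages at every step. Hence there is
exactly one zero, and it is positive (`exists_zero`). For larger `t` the pressure is negative.
Dynamical nets then cover the Julia set by sets of diameter about `exp (S_n φ)`, and the sums of
their `t`-th powers tend to `0` (`dimH_le`).

Trapping domains come from iterated preimages of a large disc (`exists_isTrapping`). If `0` has no
bounded orbit, `c` drops out of one of them. Near a simple centre one also removes small discs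
around the critical cycle. They absorb their non-escaping images, and the contraction around the
cycle keeps repelling cycles out of them (`notMem_of_contracting`). An orbit diverging to infinity
is unbounded, so the case where all critical orbits diverge is contained in the case without bounded
ones. -/

namespace Correspondence

open Metric

/-! ### Roots and lifts through the inverse correspondence. -/

/-- Some `p`-th root of `A` is close to `z` if `z ^ p` is close to `A`. -/
theorem exists_pow_eq_norm_sub_pow_le {p : ℕ} (hp : p ≠ 0) (A z : ℂ) :
    ∃ u : ℂ, u ^ p = A ∧ ‖z - u‖ ^ p ≤ ‖z ^ p - A‖ := by
  obtain ⟨u₀, hu₀⟩ := IsAlgClosed.exists_pow_nat_eq A (Nat.pos_of_ne_zero hp)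
  have hprim := Complex.isPrimitiveRoot_exp p hp
  have hfac := hprim.pow_sub_pow_eq_prod_sub_mul z u₀ (Nat.pos_of_ne_zero hp)
  have hne : (Polynomial.nthRootsFinset p (1 : ℂ)).Nonempty := by
    rw [← Finset.card_pos, hprim.card_nthRootsFinset]
    exact Nat.pos_of_ne_zero hp
  -- In `z ^ p - A = ∏ (z - ζ u₀)` the smallest of the `p` factors has `p`-th power at most the
  -- product.
  obtain ⟨ζ, hζ, hmin⟩ := Finset.exists_min_image _ (fun ζ ↦ ‖z - ζ * u₀‖) hne
  refine ⟨ζ * u₀, ?_, ?_⟩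
  · rw [mul_pow, (Polynomial.mem_nthRootsFinset (Nat.pos_of_ne_zero hp) _).1 hζ, one_mul, hu₀]
  · rw [← hu₀, hfac, norm_prod]
    calc ‖z - ζ * u₀‖ ^ p
        = ∏ _η ∈ Polynomial.nthRootsFinset p (1 : ℂ), ‖z - ζ * u₀‖ := by
          rw [Finset.prod_const, hprim.card_nthRootsFinset]
      _ ≤ _ := Finset.prod_le_prod (fun _ _ ↦ norm_nonneg _) hmin

/-- A holomorphic function on the unit disc that omits `c` can be lifted through the inverse of
the correspondence. -/
theorem exists_lift {p q : ℕ} (hp : p ≠ 0) (hq : q ≠ 0) {c z : ℂ} {φ : ℂ → ℂ}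
    (hφ : DifferentiableOn ℂ φ (ball 0 1)) (hc : ∀ ζ ∈ ball (0 : ℂ) 1, φ ζ ≠ c)
    (hz : IsImage p q c z (φ 0)) :
    ∃ ψ : ℂ → ℂ, DifferentiableOn ℂ ψ (ball 0 1) ∧ ψ 0 = z ∧
      (∀ ζ ∈ ball (0 : ℂ) 1, IsImage p q c (ψ ζ) (φ ζ)) ∧
      ∀ ζ ∈ ball (0 : ℂ) 1, branchDeriv p q c (ψ ζ) (φ ζ) * deriv ψ ζ = deriv φ ζ := by
  have hp' : (p : ℂ) ≠ 0 := by exact_mod_cast hp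
  have hq' : (q : ℂ) ≠ 0 := by exact_mod_cast hq
  have h0 : (0 : ℂ) ∈ ball (0 : ℂ) 1 := by simp
  have hz0 : z ≠ 0 := by
    rintro rfl
    rw [IsImage, zero_pow hp] at hz
    exact hc 0 h0 (sub_eq_zero.1 (pow_eq_zero_iff hq |>.1 hz))
  have hsub : ∀ ζ ∈ ball (0 : ℂ) 1, φ ζ - c ≠ 0 := fun ζ hζ ↦ sub_ne_zero.2 (hc ζ hζ)
  have hφ' : ∀ ζ ∈ ball (0 : ℂ) 1, HasDerivAt φ (deriv φ ζ) ζ := fun ζ hζ ↦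
    (hφ.differentiableAt (isOpen_ball.mem_nhds hζ)).hasDerivAt
  have hd : DifferentiableOn ℂ (fun ζ ↦ deriv φ ζ / (φ ζ - c)) (ball 0 1) :=
    (hφ.deriv isOpen_ball).div (hφ.sub_const c) hsub
  -- `g` is a logarithm of `(φ - c) / (φ 0 - c)`, so `z * exp (q / p * g)` is the required `p`-th
  -- root of `(φ - c) ^ q`.
  obtain ⟨g, hg0, hg⟩ := hd.isExactOn_ball.with_val_at 0 0
  have hlog : ∀ ζ ∈ ball (0 : ℂ) 1, φ ζ - c = (φ 0 - c) * Complex.exp (g ζ) := by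
    have hder : ∀ ζ ∈ ball (0 : ℂ) 1,
        HasDerivAt (fun ζ ↦ (φ ζ - c) * Complex.exp (-g ζ)) 0 ζ := by
      intro ζ hζ
      refine (((hφ' ζ hζ).sub_const c).fun_mul (hg ζ hζ).fun_neg.cexp).congr_deriv ?_
      have := hsub ζ hζ
      field_simp
      ring
    intro ζ hζ
    have hconst := (convex_ball (0 : ℂ) 1).is_const_of_fderivWithin_eq_zero
      (f := fun ζ ↦ (φ ζ - c) * Complex.exp (-g ζ)) (𝕜 := ℂ)
      (fun ζ hζ ↦ (hder ζ hζ).differentiableAt.differentiableWithinAt)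
      (fun ζ hζ ↦ by
        rw [fderivWithin_of_isOpen isOpen_ball hζ]
        ext
        simp [(hder ζ hζ).deriv]) hζ h0
    simp only [hg0, neg_zero, Complex.exp_zero, mul_one] at hconst
    rw [← hconst, mul_assoc, ← Complex.exp_add]
    simp
  have hψ : ∀ ζ ∈ ball (0 : ℂ) 1, HasDerivAt (fun ζ ↦ z * Complex.exp (q / p * g ζ))
      (z * (Complex.exp (q / p * g ζ) * (q / p * (deriv φ ζ / (φ ζ - c))))) ζ := fun ζ hζ ↦
    (((hg ζ hζ).const_mul _).cexp).const_mul z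
  refine ⟨fun ζ ↦ z * Complex.exp (q / p * g ζ),
    fun ζ hζ ↦ (hψ ζ hζ).differentiableAt.differentiableWithinAt, by simp [hg0], ?_, ?_⟩
  · intro ζ hζ
    rw [IsImage, hlog ζ hζ, mul_pow, mul_pow, hz, ← Complex.exp_nat_mul, ← Complex.exp_nat_mul]
    congr 2
    field_simp
  · intro ζ hζ
    rw [(hψ ζ hζ).deriv, branchDeriv]
    have h1 := hsub ζ hζ
    have h2 := Complex.exp_ne_zero (q / p * g ζ)
    field_simp

/-! ### Trapping domains and uniform expansion. -/

/-- A bounded domain `U` that contains the repelling cycles, omits the critical value, and whose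
preimage under the correspondence is well inside `U`. -/
structure IsTrapping (p q : ℕ) (c : ℂ) (U : Set ℂ) (ε R : ℝ) : Prop where
  isOpen : IsOpen U
  nonempty : U.Nonempty
  critical : c ∉ U
  eps_pos : 0 < ε
  R_pos : 0 < R
  dist_le : ∀ z ∈ U, ∀ w ∈ U, dist z w ≤ R
  ball_subset : ∀ z w, IsImage p q c z w → w ∈ U → ball z ε ⊆ U
  cycle : ∀ n z, IsRepellingCycle p q c n z → ∀ i < n, z i ∈ U

variable {p q : ℕ} {c : ℂ} {U : Set ℂ} {ε R : ℝ}

namespace IsTrapping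

theorem mem_of_image (hT : IsTrapping p q c U ε R) {z w : ℂ} (h : IsImage p q c z w)
    (hw : w ∈ U) : z ∈ U :=
  hT.ball_subset z w h hw (mem_ball_self hT.eps_pos)

theorem ne_zero_of_image (hT : IsTrapping p q c U ε R) (hp : p ≠ 0) (hq : q ≠ 0) {z w : ℂ}
    (h : IsImage p q c z w) (hw : w ∈ U) : z ≠ 0 := by
  rintro rfl
  rw [IsImage, zero_pow hp, pow_eq_zero_iff hq, sub_eq_zero] at h
  exact hT.critical (h ▸ hw)

theorem one_lt (hT : IsTrapping p q c U ε R) : 1 < 1 + ε / R := by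
  have := div_pos hT.eps_pos hT.R_pos
  linarith

/-- A disc in the preimage of `U` can be enlarged by a definite factor inside `U`. -/
theorem exists_enlarge (hT : IsTrapping p q c U ε R) {ψ φ : ℂ → ℂ}
    (hψ : DifferentiableOn ℂ ψ (ball 0 1)) (hφ : Set.MapsTo φ (ball 0 1) U)
    (h : ∀ ζ ∈ ball (0 : ℂ) 1, IsImage p q c (ψ ζ) (φ ζ)) :
    ∃ χ : ℂ → ℂ, DifferentiableOn ℂ χ (ball 0 1) ∧ Set.MapsTo χ (ball 0 1) U ∧ χ 0 = ψ 0 ∧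
      deriv χ 0 = (1 + ε / R : ℝ) * deriv ψ 0 := by
  have h0 : (0 : ℂ) ∈ ball (0 : ℂ) 1 := by simp
  have hR := hT.R_pos
  have hmem : ∀ ζ ∈ ball (0 : ℂ) 1, ψ ζ ∈ U := fun ζ hζ ↦ hT.mem_of_image (h ζ hζ) (hφ hζ)
  have hbound : ‖deriv ψ 0‖ ≤ R := by
    have := Complex.norm_deriv_le_div_of_mapsTo_ball hψ
      (fun ζ hζ ↦ mem_closedBall.2 (hT.dist_le _ (hmem ζ hζ) _ (hmem 0 h0))) one_pos
    simpa using this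
  -- The added linear term has modulus below `ε`, because `‖deriv ψ 0‖ ≤ R` by Cauchy's estimate;
  -- hence the values stay in `U`.
  refine ⟨fun ζ ↦ ψ ζ + (ε / R : ℝ) * deriv ψ 0 * ζ, ?_, ?_, by simp, ?_⟩
  · fun_prop
  · intro ζ hζ
    refine hT.ball_subset _ _ (h ζ hζ) (hφ hζ) ?_
    rw [mem_ball, dist_eq_norm, add_sub_cancel_left, norm_mul, norm_mul, Complex.norm_real,
      Real.norm_of_nonneg (div_pos hT.eps_pos hR).le]
    have hζ' : ‖ζ‖ < 1 := by simpa using hζ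
    calc ε / R * ‖deriv ψ 0‖ * ‖ζ‖ ≤ ε / R * R * ‖ζ‖ := by
          have := (div_pos hT.eps_pos hR).le
          gcongr
      _ = ε * ‖ζ‖ := by field_simp
      _ < ε := mul_lt_of_lt_one_right hT.eps_pos hζ'
  · have h1 := (hψ.differentiableAt (isOpen_ball.mem_nhds h0)).hasDerivAt
    have h2 := h1.add ((hasDerivAt_id (0 : ℂ)).const_mul ((ε / R : ℝ) * deriv ψ 0))
    rw [show (fun ζ ↦ ψ ζ + (ε / R : ℝ) * deriv ψ 0 * ζ) =
      ψ + fun ζ ↦ ((ε / R : ℝ) : ℂ) * deriv ψ 0 * id ζ from rfl, h2.deriv]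
    push_cast
    ring

/-- Each step backwards lifts the disc and then enlarges it. The enlarged disc is no longer a lift,
but only its centre and the derivative there are tracked, and that derivative gains the factor `1 +
ε / R` every time. -/
theorem exists_disc (hT : IsTrapping p q c U ε R) (hp : p ≠ 0) (hq : q ≠ 0) {d : ℝ}
    (hd : 0 < d) (n : ℕ) (x : ℕ → ℂ) (hx : ∀ i < n, IsImage p q c (x i) (x (i + 1)))
    (hb : ball (x n) d ⊆ U) :
    ∃ ψ : ℂ → ℂ, DifferentiableOn ℂ ψ (ball 0 1) ∧ Set.MapsTo ψ (ball 0 1) U ∧ ψ 0 = x 0 ∧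
      ‖∏ i ∈ Finset.range n, branchDeriv p q c (x i) (x (i + 1))‖ * ‖deriv ψ 0‖ =
        d * (1 + ε / R) ^ n := by
  induction n generalizing x with
  | zero =>
    refine ⟨fun ζ ↦ x 0 + d * ζ, by fun_prop, ?_, by simp, ?_⟩
    · intro ζ hζ
      apply hb
      have hζ' : ‖ζ‖ < 1 := by simpa using hζ
      rw [mem_ball, dist_eq_norm, add_sub_cancel_left, norm_mul, Complex.norm_real,
        Real.norm_of_nonneg hd.le]
      exact mul_lt_of_lt_one_right hd hζ'
    · simp [abs_of_pos hd]
  | succ n ih =>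
    obtain ⟨φ, hφ, hφU, hφ0, hder⟩ := ih (fun i ↦ x (i + 1)) (fun i hi ↦ hx (i + 1) (by omega)) hb
    have hc : ∀ ζ ∈ ball (0 : ℂ) 1, φ ζ ≠ c := fun ζ hζ h ↦ hT.critical (h ▸ hφU hζ)
    have h0 : (0 : ℂ) ∈ ball (0 : ℂ) 1 := by simp
    obtain ⟨ψ, hψ, hψ0, him, hψd⟩ := exists_lift hp hq hφ hc (z := x 0)
      (by rw [hφ0]; exact hx 0 (by omega))
    obtain ⟨χ, hχ, hχU, hχ0, hχd⟩ := hT.exists_enlarge hψ hφU him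
    refine ⟨χ, hχ, hχU, hχ0.trans hψ0, ?_⟩
    have h1 := hψd 0 h0
    rw [hψ0, hφ0] at h1
    rw [← h1, norm_mul, ← mul_assoc, ← norm_mul] at hder
    rw [Finset.prod_range_succ', hχd, norm_mul ((1 + ε / R : ℝ) : ℂ), Complex.norm_real,
      Real.norm_of_nonneg (zero_le_one.trans hT.one_lt.le), pow_succ]
    linear_combination (1 + ε / R) * hder

/-- The correspondence is uniformly expanding along orbits in the domain. -/
theorem le_norm_prod_branchDeriv (hT : IsTrapping p q c U ε R) (hp : p ≠ 0) (hq : q ≠ 0) {d : ℝ}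
    (hd : 0 < d) (n : ℕ) (x : ℕ → ℂ) (hx : ∀ i < n, IsImage p q c (x i) (x (i + 1)))
    (hb : ball (x n) d ⊆ U) :
    d / R * (1 + ε / R) ^ n ≤
      ‖∏ i ∈ Finset.range n, branchDeriv p q c (x i) (x (i + 1))‖ := by
  obtain ⟨ψ, hψ, hψU, hψ0, hder⟩ := hT.exists_disc hp hq hd n x hx hb
  have h0 : (0 : ℂ) ∈ ball (0 : ℂ) 1 := by simp
  have hbound : ‖deriv ψ 0‖ ≤ R := by
    have := Complex.norm_deriv_le_div_of_mapsTo_ball hψ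
      (fun ζ hζ ↦ mem_closedBall.2 (hT.dist_le _ (hψU hζ) _ (hψU h0))) one_pos
    simpa using this
  rw [div_mul_eq_mul_div, div_le_iff₀ hT.R_pos, ← hder]
  gcongr

/-- Pulling back a holomorphic disc in the domain along a finite orbit. -/
theorem exists_pullback (hT : IsTrapping p q c U ε R) (hp : p ≠ 0) (hq : q ≠ 0) {φ : ℂ → ℂ}
    (hφ : DifferentiableOn ℂ φ (ball 0 1)) (hφU : Set.MapsTo φ (ball 0 1) U)
    (n : ℕ) (x : ℕ → ℂ) (hx : ∀ i < n, IsImage p q c (x i) (x (i + 1))) (hφ0 : φ 0 = x n) :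
    ∃ Ψ : ℕ → ℂ → ℂ, DifferentiableOn ℂ (Ψ 0) (ball 0 1) ∧ Set.MapsTo (Ψ 0) (ball 0 1) U ∧
      Ψ 0 0 = x 0 ∧ Ψ n = φ ∧
      (∀ ζ ∈ ball (0 : ℂ) 1, ∀ i < n, IsImage p q c (Ψ i ζ) (Ψ (i + 1) ζ)) ∧
      ∀ ζ ∈ ball (0 : ℂ) 1,
        (∏ i ∈ Finset.range n, branchDeriv p q c (Ψ i ζ) (Ψ (i + 1) ζ)) * deriv (Ψ 0) ζ =
          deriv φ ζ := by
  induction n generalizing x with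
  | zero => exact ⟨fun _ ↦ φ, hφ, hφU, hφ0, rfl, by simp, by simp⟩
  | succ n ih =>
    obtain ⟨Φ, h1, h2, h3, h4, h5, h6⟩ := ih (fun i ↦ x (i + 1))
      (fun i hi ↦ hx (i + 1) (by omega)) hφ0
    obtain ⟨ψ, hψ, hψ0, him, hψd⟩ := exists_lift hp hq h1
      (fun ζ hζ (h : Φ 0 ζ = c) ↦ hT.critical (h ▸ h2 hζ)) (z := x 0) (by rw [h3]; exact hx 0 (by omega))
    refine ⟨fun i ↦ Nat.casesOn i ψ Φ, hψ, fun ζ hζ ↦ hT.mem_of_image (him ζ hζ) (h2 hζ),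
      hψ0, h4, ?_, ?_⟩
    · rintro ζ hζ (_ | i) hi
      · exact him ζ hζ
      · exact h5 ζ hζ i (by omega)
    · intro ζ hζ
      rw [Finset.prod_range_succ', mul_assoc]
      exact (congrArg _ (hψd ζ hζ)).trans (h6 ζ hζ)

/-- Closing lemma: a long orbit that almost returns is close to a closed orbit. -/
theorem exists_closed_orbit (hT : IsTrapping p q c U ε R) (hp : p ≠ 0) (hq : q ≠ 0) {δ : ℝ}
    (hδ : 0 < δ) : ∃ N : ℕ, ∀ n ≥ N, ∀ x : ℕ → ℂ, (∀ i < n, IsImage p q c (x i) (x (i + 1))) →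
      ball (x n) δ ⊆ U → dist (x 0) (x n) < δ / 4 →
      ∃ y : ℕ → ℂ, (∀ i < n, IsImage p q c (y i) (y (i + 1))) ∧ y n = y 0 ∧ y 0 ∈ U ∧
        dist (y 0) (x n) < δ := by
  have hR := hT.R_pos
  obtain ⟨N, hN⟩ := pow_unbounded_of_one_lt (4 * R / δ) hT.one_lt
  refine ⟨N, fun n hn x hx hb hret ↦ ?_⟩
  set Λ := (1 + ε / R) ^ n with hΛ
  have hΛpos : 0 < Λ := pow_pos (zero_lt_one.trans hT.one_lt) _
  have hΛN : 4 * R / δ ≤ Λ := hN.le.trans (pow_le_pow_right₀ hT.one_lt.le hn)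
  have hsmall : 2 * R / Λ ≤ δ / 2 := by
    rw [div_le_iff₀ hΛpos]
    rw [div_le_iff₀ hδ] at hΛN
    nlinarith
  set φ : ℂ → ℂ := fun ζ ↦ x n + δ * ζ with hφdef
  have hφU : Set.MapsTo φ (ball 0 1) U := by
    intro ζ hζ
    apply hb
    have hζ' : ‖ζ‖ < 1 := by simpa using hζ
    rw [mem_ball, dist_eq_norm, add_sub_cancel_left, norm_mul, Complex.norm_real,
      Real.norm_of_nonneg hδ.le]
    exact mul_lt_of_lt_one_right hδ hζ'
  have hφd : ∀ ζ, deriv φ ζ = δ := fun ζ ↦ by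
    simp [φ]
  obtain ⟨Ψ, h1, h2, h3, h4, h5, h6⟩ := hT.exists_pullback hp hq (φ := φ)
    (by fun_prop) hφU n x hx (by simp [φ])
  have hsub : closedBall (0 : ℂ) (1 / 2) ⊆ ball 0 1 := closedBall_subset_ball (by norm_num)
  -- Around `Ψ n ζ` there is still a disc of radius `δ / 2` in `U`, so the forward product is at
  -- least `δ / (2 * R) * Λ` and the pullback has derivative at most `2 * R / Λ ≤ δ / 2`.
  have hder : ∀ ζ ∈ closedBall (0 : ℂ) (1 / 2), ‖deriv (Ψ 0) ζ‖ ≤ δ / 2 := by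
    intro ζ hζ
    have hζ' : ‖ζ‖ ≤ 1 / 2 := by simpa using hζ
    have hbb : ball (Ψ n ζ) (δ / 2) ⊆ U := by
      refine Set.Subset.trans (fun y hy ↦ ?_) hb
      rw [h4] at hy
      have : dist (φ ζ) (x n) ≤ δ * (1 / 2) := by
        rw [dist_eq_norm, add_sub_cancel_left, norm_mul, Complex.norm_real,
          Real.norm_of_nonneg hδ.le]
        gcongr
      rw [mem_ball] at hy ⊢
      linarith [dist_triangle y (φ ζ) (x n)]
    have hexp := hT.le_norm_prod_branchDeriv hp hq (half_pos hδ) n (fun i ↦ Ψ i ζ)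
      (h5 ζ (hsub hζ)) hbb
    have hmul := congrArg norm (h6 ζ (hsub hζ))
    rw [hφd, norm_mul, Complex.norm_real, Real.norm_of_nonneg hδ.le] at hmul
    refine le_trans ?_ hsmall
    rw [le_div_iff₀ hΛpos]
    have h7 : δ / 2 / R * Λ * ‖deriv (Ψ 0) ζ‖ ≤ δ :=
      (mul_le_mul_of_nonneg_right hexp (norm_nonneg _)).trans hmul.le
    have h8 : δ / 2 / R * Λ * ‖deriv (Ψ 0) ζ‖ = δ * (‖deriv (Ψ 0) ζ‖ * Λ / (2 * R)) := by
      field_simp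
    rw [h8] at h7
    have h9 := (mul_le_iff_le_one_right hδ).1 h7
    rwa [div_le_one (by positivity)] at h9
  have hlip : ∀ ζ ∈ closedBall (0 : ℂ) (1 / 2), ∀ ξ ∈ closedBall (0 : ℂ) (1 / 2),
      ‖Ψ 0 ξ - Ψ 0 ζ‖ ≤ δ / 2 * ‖ξ - ζ‖ := fun ζ hζ ξ hξ ↦
    (convex_closedBall (0 : ℂ) (1 / 2)).norm_image_sub_le_of_norm_deriv_le
      (fun ζ hζ ↦ h1.differentiableAt (isOpen_ball.mem_nhds (hsub hζ))) hder hζ hξ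
  -- A fixed point of `T` satisfies `Ψ 0 ζ = φ ζ = Ψ n ζ`, so its orbit closes up. The half disc is
  -- preserved because `δ / 4` comes from the Lipschitz bound and `δ / 4` from the near return.
  set T : ℂ → ℂ := fun ζ ↦ (Ψ 0 ζ - x n) / δ with hTdef
  have hδ' : (δ : ℂ) ≠ 0 := by exact_mod_cast hδ.ne'
  have hmaps : Set.MapsTo T (closedBall 0 (1 / 2)) (closedBall 0 (1 / 2)) := by
    intro ζ hζ
    have hl := hlip 0 (by simp) ζ hζ
    rw [h3, sub_zero] at hl
    have hζ' : ‖ζ‖ ≤ 1 / 2 := by simpa using hζ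
    rw [mem_closedBall, dist_zero_right, norm_div, Complex.norm_real,
      Real.norm_of_nonneg hδ.le, div_le_iff₀ hδ]
    rw [dist_eq_norm] at hret
    calc ‖Ψ 0 ζ - x n‖ ≤ ‖Ψ 0 ζ - x 0‖ + ‖x 0 - x n‖ := norm_sub_le_norm_sub_add_norm_sub _ _ _
      _ ≤ δ / 2 * (1 / 2) + δ / 4 := by
          refine add_le_add (hl.trans ?_) hret.le
          gcongr
      _ = 1 / 2 * δ := by ring
  have hcontr : ContractingWith (1 / 2) (hmaps.restrict T _ _) := by
    refine ⟨by norm_num, LipschitzWith.of_dist_le_mul fun ζ ξ ↦ ?_⟩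
    change dist (T ζ) (T ξ) ≤ _ * dist (ζ : ℂ) ξ
    have hl := hlip ξ ξ.2 ζ ζ.2
    rw [dist_eq_norm, dist_eq_norm, ← sub_div, sub_sub_sub_cancel_right, norm_div,
      Complex.norm_real, Real.norm_of_nonneg hδ.le, div_le_iff₀ hδ]
    refine hl.trans (le_of_eq ?_)
    push_cast
    ring
  obtain ⟨ζ, hζ, hfix, -, -⟩ := hcontr.exists_fixedPoint' isClosed_closedBall.isComplete hmaps
    (x := 0) (by simp) (edist_ne_top _ _)
  have hfix' : Ψ 0 ζ = φ ζ := by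
    have h : (Ψ 0 ζ - x n) / δ = ζ := hfix
    rw [div_eq_iff hδ'] at h
    rw [hφdef]
    linear_combination h
  have hζ' : ‖ζ‖ ≤ 1 / 2 := by simpa using hζ
  refine ⟨fun i ↦ Ψ i ζ, h5 ζ (hsub hζ), ?_, h2 (hsub hζ), ?_⟩
  · simp only [h4, hfix']
  · simp only [hfix', hφdef]
    rw [dist_eq_norm, add_sub_cancel_left, norm_mul, Complex.norm_real,
      Real.norm_of_nonneg hδ.le]
    nlinarith

end IsTrapping


/-! ### Preimages, finite orbits and periodic extensions. -/

theorem isClosed_exists_mem_of_isCompact {X Y : Type*} [TopologicalSpace X] [TopologicalSpace Y]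
    {K : Set Y} (hK : IsCompact K) {C : Set (X × Y)} (hC : IsClosed C) :
    IsClosed {x | ∃ y ∈ K, (x, y) ∈ C} := by
  have : CompactSpace K := isCompact_iff_compactSpace.1 hK
  have h : IsClosed {z : X × K | (z.1, (z.2 : Y)) ∈ C} := hC.preimage (by fun_prop)
  convert isClosedMap_fst_of_compactSpace _ h using 1
  ext x
  simp

theorem prod_range_mul_of_periodic {M : Type*} [CommMonoid M] {f : ℕ → M} {m : ℕ}
    (hf : Function.Periodic f m) (k : ℕ) :
    ∏ i ∈ Finset.range (k * m), f i = (∏ i ∈ Finset.range m, f i) ^ k := by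
  induction k with
  | zero => simp
  | succ k ih =>
    rw [Nat.succ_mul, Finset.prod_range_add, ih, pow_succ]
    congr 1
    refine Finset.prod_congr rfl fun i _ ↦ ?_
    rw [add_comm]
    exact hf.nat_mul k i

/-- The points with an image in `S`. -/
def preimage (p q : ℕ) (c : ℂ) (S : Set ℂ) : Set ℂ := {z | ∃ w ∈ S, IsImage p q c z w}

theorem isClosed_isImage (p q : ℕ) (c : ℂ) : IsClosed {z : ℂ × ℂ | IsImage p q c z.1 z.2} :=
  isClosed_eq (by fun_prop) (by fun_prop)

theorem isClosed_preimage {S : Set ℂ} (hS : IsCompact S) : IsClosed (preimage p q c S) :=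
  isClosed_exists_mem_of_isCompact hS (isClosed_isImage p q c)

theorem exists_isImage_left (hp : p ≠ 0) (c w : ℂ) : ∃ z, IsImage p q c z w := by
  obtain ⟨u, hu⟩ := IsAlgClosed.exists_pow_nat_eq ((w - c) ^ q) (Nat.pos_of_ne_zero hp)
  exact ⟨u, hu.symm⟩

/-- Preimages vary continuously: moving `w` slightly moves `(w - c) ^ q` slightly, and some `p`-th
root of the new value remains near `z`. -/
theorem preimage_closure_subset (hp : p ≠ 0) (S : Set ℂ) :
    preimage p q c (closure S) ⊆ closure (preimage p q c S) := by
  rintro z ⟨w, hw, hzw⟩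
  rw [Metric.mem_closure_iff]
  intro δ hδ
  have hcont : Continuous fun w' : ℂ ↦ ‖z ^ p - (w' - c) ^ q‖ := by fun_prop
  have hopen : IsOpen {w' : ℂ | ‖z ^ p - (w' - c) ^ q‖ < δ ^ p} :=
    isOpen_lt hcont continuous_const
  have hmem : w ∈ {w' : ℂ | ‖z ^ p - (w' - c) ^ q‖ < δ ^ p} := by
    have h : (w - c) ^ q = z ^ p := hzw
    simp [h, pow_pos hδ]
  obtain ⟨w', hw', hw'S⟩ := mem_closure_iff.1 hw _ hopen hmem
  obtain ⟨u, hu, hzu⟩ := exists_pow_eq_norm_sub_pow_le hp ((w' - c) ^ q) z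
  refine ⟨u, ⟨w', hw'S, hu.symm⟩, ?_⟩
  rw [dist_eq_norm]
  exact lt_of_pow_lt_pow_left₀ p hδ.le (hzu.trans_lt hw')

/-- The sequence `u, x 0, x 1, …`. -/
def cons (u : ℂ) (x : ℕ → ℂ) : ℕ → ℂ
  | 0 => u
  | i + 1 => x i

@[simp] theorem cons_zero (u : ℂ) (x : ℕ → ℂ) : cons u x 0 = u := rfl

@[simp] theorem cons_succ (u : ℂ) (x : ℕ → ℂ) (i : ℕ) : cons u x (i + 1) = x i := rfl

theorem exists_backward_orbit (hp : p ≠ 0) (c z : ℂ) (n : ℕ) :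
    ∃ x : ℕ → ℂ, (∀ i < n, IsImage p q c (x i) (x (i + 1))) ∧ x n = z := by
  induction n with
  | zero => exact ⟨fun _ ↦ z, by simp, rfl⟩
  | succ n ih =>
    obtain ⟨x, hx, hxn⟩ := ih
    obtain ⟨u, hu⟩ := exists_isImage_left (q := q) hp c (x 0)
    refine ⟨cons u x, ?_, hxn⟩
    rintro (_ | i) hi
    · exact hu
    · exact hx i (by omega)

/-- Sets that contain the preimages of their points contain the finite orbits ending in them. -/
theorem mem_of_orbit {S : Set ℂ} (hS : preimage p q c S ⊆ S) {n : ℕ} {x : ℕ → ℂ}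
    (hx : ∀ i < n, IsImage p q c (x i) (x (i + 1))) (hn : x n ∈ S) : ∀ i ≤ n, x i ∈ S := by
  induction n with
  | zero =>
    intro i hi
    rwa [Nat.le_zero.1 hi]
  | succ n ih =>
    intro i hi
    rcases Nat.lt_or_eq_of_le hi with h | rfl
    · exact ih (fun i hi ↦ hx i (by omega)) (hS ⟨_, hn, hx n (by omega)⟩) i (by omega)
    · exact hn

theorem isImage_mod {n : ℕ} {z : ℕ → ℂ} (h0 : 0 < n)
    (h : ∀ i < n, IsImage p q c (z i) (z (i + 1))) (hn : z n = z 0) (i : ℕ) :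
    IsImage p q c (z (i % n)) (z ((i + 1) % n)) := by
  have h1 := h (i % n) (Nat.mod_lt _ h0)
  rw [Nat.add_mod]
  rcases Nat.lt_or_eq_of_le (Nat.succ_le_of_lt (Nat.mod_lt i h0)) with h2 | h2
  · rcases Nat.lt_or_eq_of_le (Nat.succ_le_of_lt h0) with h3 | h3
    · rwa [Nat.mod_eq_of_lt h3, Nat.mod_eq_of_lt h2]
    · subst h3
      simp only [Nat.mod_one] at h2
      omega
  · rcases Nat.lt_or_eq_of_le (Nat.succ_le_of_lt h0) with h3 | h3
    · rw [Nat.mod_eq_of_lt h3, show i % n + 1 = n from h2, Nat.mod_self, ← hn]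
      rwa [show i % n + 1 = n from h2] at h1
    · subst h3
      simp only [Nat.mod_one] at h1 ⊢
      rwa [show z (0 + 1) = z 0 from hn] at h1

theorem branchDeriv_mod_periodic {z : ℕ → ℂ} (n : ℕ) :
    Function.Periodic (fun i ↦ branchDeriv p q c (z (i % n)) (z ((i + 1) % n))) n := by
  intro i
  simp only [Nat.add_mod_right, show i + n + 1 = i + 1 + n by ring]

theorem prod_branchDeriv_mod {n : ℕ} {z : ℕ → ℂ} (hn : z n = z 0) (k : ℕ) :
    ∏ i ∈ Finset.range (k * n), branchDeriv p q c (z (i % n)) (z ((i + 1) % n)) =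
      (∏ i ∈ Finset.range n, branchDeriv p q c (z i) (z (i + 1))) ^ k := by
  rw [prod_range_mul_of_periodic (branchDeriv_mod_periodic n)]
  congr 1
  refine Finset.prod_congr rfl fun i hi ↦ ?_
  have hi := Finset.mem_range.1 hi
  rw [Nat.mod_eq_of_lt hi]
  rcases Nat.lt_or_eq_of_le (Nat.succ_le_of_lt hi) with h | h
  · rw [Nat.mod_eq_of_lt h]
  · rw [show i + 1 = n from h, Nat.mod_self, hn]

/-! ### The Julia set inside a trapping domain. -/

namespace IsTrapping

theorem preimage_subset (hT : IsTrapping p q c U ε R) : preimage p q c U ⊆ U := by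
  rintro z ⟨w, hw, h⟩
  exact hT.mem_of_image h hw

/-- Running `k` times around the closed orbit raises the multiplier to the power `k`. This would
stay bounded by `1`, whereas uniform expansion makes it unbounded. -/
theorem one_lt_norm_prod (hT : IsTrapping p q c U ε R) (hp : p ≠ 0) (hq : q ≠ 0) {n : ℕ}
    (h0 : 0 < n) {y : ℕ → ℂ} (hy : ∀ i < n, IsImage p q c (y i) (y (i + 1))) (hn : y n = y 0)
    (hU : y 0 ∈ U) : 1 < ‖∏ i ∈ Finset.range n, branchDeriv p q c (y i) (y (i + 1))‖ := by
  by_contra! hle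
  obtain ⟨d, hd, hball⟩ := Metric.isOpen_iff.1 hT.isOpen _ hU
  have hR := hT.R_pos
  obtain ⟨k, hk⟩ := pow_unbounded_of_one_lt (R / d) hT.one_lt
  have h1 := hT.le_norm_prod_branchDeriv hp hq hd (k * n) (fun i ↦ y (i % n))
    (fun i _ ↦ isImage_mod h0 hy hn i) (by simpa using hball)
  rw [prod_branchDeriv_mod hn, norm_pow] at h1
  have h2 := h1.trans (pow_le_one₀ (norm_nonneg _) hle)
  have h3 : (1 + ε / R) ^ k ≤ (1 + ε / R) ^ (k * n) :=
    pow_le_pow_right₀ hT.one_lt.le (Nat.le_mul_of_pos_right k h0)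
  have h4 : d / R * (R / d) = 1 := by field_simp
  have h5 : d / R * (R / d) < d / R * (1 + ε / R) ^ (k * n) :=
    mul_lt_mul_of_pos_left (hk.trans_le h3) (div_pos hd hR)
  linarith

theorem mem_juliaSet_of_closed_orbit (hT : IsTrapping p q c U ε R) (hp : p ≠ 0) (hq : q ≠ 0)
    {n : ℕ} (h0 : 0 < n) {y : ℕ → ℂ} (hy : ∀ i < n, IsImage p q c (y i) (y (i + 1)))
    (hn : y n = y 0) (hU : y 0 ∈ U) : y 0 ∈ juliaSet p q c := by
  classical
  -- A repelling cycle must return for the first time, so the closed orbit is cut at its minimal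
  -- return time.
  have hex : ∃ m, 0 < m ∧ y m = y 0 := ⟨n, h0, hn⟩
  obtain ⟨hm0, hm⟩ := Nat.find_spec hex
  have hmn : Nat.find hex ≤ n := Nat.find_min' hex ⟨h0, hn⟩
  set m := Nat.find hex with hmdef
  have hym : ∀ i < m, IsImage p q c (y i) (y (i + 1)) := fun i hi ↦ hy i (by omega)
  have hall := mem_of_orbit hT.preimage_subset hym (by rwa [hm])
  refine subset_closure ⟨m, y, ⟨hm0, hym, hm, ?_, ?_, ?_⟩, 0, hm0, rfl⟩
  · intro i hi him h
    exact Nat.find_min hex him ⟨hi, h⟩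
  · exact fun i hi ↦ hT.ne_zero_of_image hp hq (hym i hi) (hall (i + 1) hi)
  · exact hT.one_lt_norm_prod hp hq hm0 hym hm hU

/-- The full radius `ε` survives passage to the closure because the balls are open: a point at
distance less than `ε` leaves room to move the centre. -/
theorem ball_subset_of_mem_closure (hT : IsTrapping p q c U ε R) {z : ℂ}
    (hz : z ∈ closure (preimage p q c U)) : ball z ε ⊆ U := by
  intro y hy
  obtain ⟨z', ⟨w, hw, hzw⟩, hz'⟩ := Metric.mem_closure_iff.1 hz (ε - dist y z)
    (sub_pos.2 (mem_ball.1 hy))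
  apply hT.ball_subset z' w hzw hw
  rw [mem_ball]
  linarith [dist_triangle y z z']

theorem closure_preimage_subset (hT : IsTrapping p q c U ε R) :
    closure (preimage p q c U) ⊆ U :=
  fun _ hz ↦ hT.ball_subset_of_mem_closure hz (mem_ball_self hT.eps_pos)

theorem isBounded (hT : IsTrapping p q c U ε R) : Bornology.IsBounded U :=
  Metric.isBounded_iff.2 ⟨R, fun z hz w hw ↦ hT.dist_le z hz w hw⟩

theorem juliaSet_subset (hT : IsTrapping p q c U ε R) :
    juliaSet p q c ⊆ closure (preimage p q c U) := by
  refine closure_mono ?_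
  rintro ζ ⟨n, z, hz, i, hi, rfl⟩
  refine ⟨z (i + 1), ?_, hz.2.1 i hi⟩
  rcases Nat.lt_or_eq_of_le (Nat.succ_le_of_lt hi) with h | h
  · exact hT.cycle n z hz _ h
  · rw [show i + 1 = n from h, hz.2.2.1]
    exact hT.cycle n z hz 0 hz.1

theorem juliaSet_subset_domain (hT : IsTrapping p q c U ε R) : juliaSet p q c ⊆ U :=
  hT.juliaSet_subset.trans hT.closure_preimage_subset

theorem isCompact_juliaSet (hT : IsTrapping p q c U ε R) : IsCompact (juliaSet p q c) :=
  Metric.isCompact_of_isClosed_isBounded isClosed_closure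
    (hT.isBounded.subset hT.juliaSet_subset_domain)

/-- On a cycle the next point is again on the cycle, and compactness carries this over to the
closure. Iterating it gives every Julia point a forward orbit inside the Julia set. -/
theorem juliaSet_subset_preimage (hT : IsTrapping p q c U ε R) :
    juliaSet p q c ⊆ preimage p q c (juliaSet p q c) := by
  refine closure_minimal ?_ (isClosed_preimage hT.isCompact_juliaSet)
  rintro ζ ⟨n, z, hz, i, hi, rfl⟩
  refine ⟨z (i + 1), subset_closure ?_, hz.2.1 i hi⟩
  rcases Nat.lt_or_eq_of_le (Nat.succ_le_of_lt hi) with h | h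
  · exact ⟨n, z, hz, i + 1, h, rfl⟩
  · exact ⟨n, z, hz, 0, hz.1, by rw [show i + 1 = n from h, hz.2.2.1]⟩

theorem exists_mem_orbitSpace (hT : IsTrapping p q c U ε R) {z : ℂ} (hz : z ∈ juliaSet p q c) :
    ∃ x ∈ orbitSpace p q c, x 0 = z := by
  choose! g hgJ hg using hT.juliaSet_subset_preimage
  have hmem : ∀ i, g^[i] z ∈ juliaSet p q c := by
    intro i
    induction i with
    | zero => exact hz
    | succ i ih =>
      rw [Function.iterate_succ_apply']
      exact hgJ ih
  refine ⟨fun i ↦ g^[i] z, ⟨fun i ↦ ?_, hmem⟩, rfl⟩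
  simp only [Function.iterate_succ_apply']
  exact hg (hmem i)

theorem isCompact_orbitSpace (hT : IsTrapping p q c U ε R) : IsCompact (orbitSpace p q c) := by
  have h1 : IsClosed {z : ℕ → ℂ | IsOrbit p q c z} := by
    simp only [IsOrbit, Set.ofPred_forall]
    exact isClosed_iInter fun i ↦ isClosed_eq (by fun_prop) (by fun_prop)
  have h2 : IsCompact (Set.pi Set.univ fun _ : ℕ ↦ juliaSet p q c) :=
    isCompact_univ_pi fun _ ↦ hT.isCompact_juliaSet
  convert h2.inter_left h1 using 1
  ext z
  simp [orbitSpace]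

/-- The only image of `0` is `c`, which lies outside `U`; thus `0` is off the closed Julia set. -/
theorem exists_le_norm (hT : IsTrapping p q c U ε R) (hp : p ≠ 0) (hq : q ≠ 0) :
    ∃ r > 0, ∀ z ∈ juliaSet p q c, r ≤ ‖z‖ := by
  have h0 : (0 : ℂ) ∉ juliaSet p q c := by
    intro h
    obtain ⟨w, hw, hzw⟩ := hT.juliaSet_subset_preimage h
    exact hT.ne_zero_of_image hp hq hzw (hT.juliaSet_subset_domain hw) rfl
  have hopen : IsOpen (juliaSet p q c)ᶜ := isClosed_closure.isOpen_compl
  obtain ⟨r, hr, hball⟩ := Metric.isOpen_iff.1 hopen 0 h0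
  refine ⟨r, hr, fun z hz ↦ ?_⟩
  by_contra! hlt
  exact hball (by simpa using hlt) hz

/-- A nonempty backward invariant subset of the Julia set. -/
theorem exists_backward_invariant (hT : IsTrapping p q c U ε R) (hp : p ≠ 0) (hq : q ≠ 0) :
    ∃ Λ ⊆ juliaSet p q c, Λ.Nonempty ∧ preimage p q c Λ ⊆ Λ := by
  set K := closure (preimage p q c U) with hK
  have hKcomp : IsCompact K := Metric.isCompact_of_isClosed_isBounded isClosed_closure
    (hT.isBounded.subset hT.closure_preimage_subset)
  have hKinv : preimage p q c K ⊆ K := by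
    rintro z ⟨w, hw, h⟩
    exact subset_closure ⟨w, hT.closure_preimage_subset hw, h⟩
  have hKne : K.Nonempty := by
    obtain ⟨w, hw⟩ := hT.nonempty
    obtain ⟨z, hz⟩ := exists_isImage_left (q := q) hp c w
    exact ⟨z, subset_closure ⟨w, hw, hz⟩⟩
  -- A minimal element of `F` will consist of points that are limits of starts of arbitrarily long
  -- orbits ending at the point itself; the closing lemma then puts it in the Julia set.
  let F : Set (Set ℂ) := {A | A ⊆ K ∧ IsClosed A ∧ A.Nonempty ∧ preimage p q c A ⊆ A}
  obtain ⟨Λ, -, hΛ⟩ := zorn_superset_nonempty F (fun C hC hchain hne ↦ by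
    obtain ⟨A₀, hA₀⟩ := hne
    refine ⟨⋂₀ C, ⟨(Set.sInter_subset_of_mem hA₀).trans (hC hA₀).1,
      isClosed_sInter fun A hA ↦ (hC hA).2.1, ?_, ?_⟩, fun A hA ↦ Set.sInter_subset_of_mem hA⟩
    · have : Nonempty C := ⟨⟨A₀, hA₀⟩⟩
      rw [Set.sInter_eq_iInter]
      refine IsCompact.nonempty_iInter_of_directed_nonempty_isCompact_isClosed _
        (fun A B ↦ (hchain.total A.2 B.2).elim (fun h ↦ ⟨A, subset_rfl, h⟩)
          fun h ↦ ⟨B, h, subset_rfl⟩) (fun A ↦ (hC A.2).2.2.1)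
        (fun A ↦ hKcomp.of_isClosed_subset (hC A.2).2.1 (hC A.2).1) fun A ↦ (hC A.2).2.1
    · rintro z ⟨w, hw, h⟩ A hA
      exact (hC hA).2.2.2 ⟨w, hw A hA, h⟩) K ⟨subset_rfl, isClosed_closure, hKne, hKinv⟩
  obtain ⟨hΛK, hΛcl, hΛne, hΛinv⟩ := hΛ.prop
  refine ⟨Λ, fun z hz ↦ ?_, hΛne, hΛinv⟩
  have hrec : ∀ N : ℕ, z ∈ closure {y | ∃ n ≥ N, ∃ x : ℕ → ℂ,
      (∀ i < n, IsImage p q c (x i) (x (i + 1))) ∧ x n = z ∧ x 0 = y} := by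
    intro N
    set S := {y | ∃ n ≥ N, ∃ x : ℕ → ℂ,
      (∀ i < n, IsImage p q c (x i) (x (i + 1))) ∧ x n = z ∧ x 0 = y} with hS
    have hSΛ : closure S ⊆ Λ := by
      refine closure_minimal ?_ hΛcl
      rintro y ⟨n, -, x, hx, hxn, rfl⟩
      exact mem_of_orbit hΛinv hx (by rwa [hxn]) 0 (Nat.zero_le _)
    have hSinv : preimage p q c S ⊆ S := by
      rintro u ⟨y, ⟨n, hn, x, hx, hxn, rfl⟩, huy⟩
      refine ⟨n + 1, by omega, cons u x, ?_, hxn, rfl⟩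
      rintro (_ | i) hi
      · exact huy
      · exact hx i (by omega)
    have hSne : S.Nonempty := by
      obtain ⟨x, hx, hxn⟩ := exists_backward_orbit (q := q) hp c z N
      exact ⟨x 0, N, le_rfl, x, hx, hxn, rfl⟩
    -- `closure S` is itself a competitor inside `Λ`, so minimality makes it all of `Λ`, and in
    -- particular it contains `z`.
    have hSF : closure S ∈ F := ⟨hSΛ.trans hΛK, isClosed_closure, hSne.closure,
      (preimage_closure_subset hp S).trans (closure_mono hSinv)⟩
    exact hΛ.le_of_le hSF hSΛ hz
  have hcl : IsClosed (juliaSet p q c) := isClosed_closure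
  rw [← hcl.closure_eq, Metric.mem_closure_iff]
  intro δ' hδ'
  set δ := min δ' ε with hδdef
  have hδ : 0 < δ := lt_min hδ' hT.eps_pos
  obtain ⟨N, hN⟩ := hT.exists_closed_orbit hp hq hδ
  obtain ⟨y, ⟨n, hn, x, hx, hxn, rfl⟩, hdist⟩ := Metric.mem_closure_iff.1 (hrec (N + 1)) (δ / 4)
    (by positivity)
  have hball : ball (x n) δ ⊆ U := by
    rw [hxn]
    exact (ball_subset_ball (min_le_right _ _)).trans (hT.ball_subset_of_mem_closure (hΛK hz))
  obtain ⟨y, hy, hyn, hyU, hyd⟩ := hN n (by omega) x hx hball (by rwa [hxn, dist_comm])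
  refine ⟨y 0, hT.mem_juliaSet_of_closed_orbit hp hq (by omega) hy hyn hyU, ?_⟩
  rw [dist_comm, ← hxn]
  exact hyd.trans_le (min_le_left _ _)

/-- There are `2 ^ n` orbits in the Julia set that are separated up to time `n`. -/
theorem exists_separated (hT : IsTrapping p q c U ε R) (hp : 2 ≤ p) (hq : q ≠ 0) :
    ∃ η > 0, ∀ n : ℕ, ∃ E : Finset (ℕ → ℂ), E.card = 2 ^ n ∧ (E : Set (ℕ → ℂ)) ⊆ orbitSpace p q c ∧
      ∀ x ∈ E, ∀ y ∈ E, x ≠ y → ∃ i < n, η ≤ dist (x i) (y i) := by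
  classical
  have hp0 : p ≠ 0 := by omega
  obtain ⟨Λ, hΛJ, ⟨w₀, hw₀⟩, hΛ⟩ := hT.exists_backward_invariant hp0 hq
  obtain ⟨r, hr, hrJ⟩ := hT.exists_le_norm hp0 hq
  obtain ⟨o, ho, ho0⟩ := hT.exists_mem_orbitSpace (hΛJ hw₀)
  set ζ := Complex.exp (2 * Real.pi * Complex.I / p) with hζ
  have hprim : IsPrimitiveRoot ζ p := Complex.isPrimitiveRoot_exp p hp0
  have hζ1 : ζ ≠ 1 := hprim.ne_one (by omega)
  choose s hs using fun w ↦ exists_isImage_left (q := q) hp0 c w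
  have hs' : ∀ w, IsImage p q c (ζ * s w) w := fun w ↦ by
    rw [IsImage, mul_pow, hprim.pow_eq_one, one_mul]
    exact hs w
  -- Two preimages of the same point differ by the rotation `ζ`, and both stay away from `0` because
  -- the Julia set does.
  have hsep : ∀ w ∈ Λ, ‖ζ - 1‖ * r ≤ dist (s w) (ζ * s w) := fun w hw ↦ by
    rw [dist_comm, dist_eq_norm, ← sub_one_mul, norm_mul]
    gcongr
    exact hrJ _ (hΛJ (hΛ ⟨w, hw, hs w⟩))
  have hcons : ∀ x ∈ orbitSpace p q c, x 0 ∈ Λ → ∀ u, IsImage p q c u (x 0) →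
      cons u x ∈ orbitSpace p q c ∧ cons u x 0 ∈ Λ := by
    intro x hx hx0 u hu
    have huΛ : u ∈ Λ := hΛ ⟨x 0, hx0, hu⟩
    refine ⟨⟨?_, ?_⟩, huΛ⟩
    · rintro (_ | i)
      · exact hu
      · exact hx.1 i
    · rintro (_ | i)
      · exact hΛJ huΛ
      · exact hx.2 i
  have hη : 0 < ‖ζ - 1‖ * r := mul_pos (norm_pos_iff.2 (sub_ne_zero.2 hζ1)) hr
  refine ⟨‖ζ - 1‖ * r, hη, fun n ↦ ?_⟩
  suffices h : ∃ E : Finset (ℕ → ℂ), E.card = 2 ^ n ∧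
      (∀ x ∈ E, x ∈ orbitSpace p q c ∧ x 0 ∈ Λ) ∧
      ∀ x ∈ E, ∀ y ∈ E, x ≠ y → ∃ i < n, ‖ζ - 1‖ * r ≤ dist (x i) (y i) by
    obtain ⟨E, h1, h2, h3⟩ := h
    exact ⟨E, h1, fun x hx ↦ (h2 x hx).1, h3⟩
  induction n with
  | zero =>
    refine ⟨{o}, by simp, by simp [ho, ho0, hw₀], ?_⟩
    intro x hx y hy hxy
    exact absurd ((Finset.mem_singleton.1 hx).trans (Finset.mem_singleton.1 hy).symm) hxy
  | succ n ih =>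
    obtain ⟨E, hcard, hE, hEsep⟩ := ih
    set b₁ : (ℕ → ℂ) → ℕ → ℂ := fun x ↦ cons (s (x 0)) x with hb₁
    set b₂ : (ℕ → ℂ) → ℕ → ℂ := fun x ↦ cons (ζ * s (x 0)) x with hb₂
    have hinj₁ : Function.Injective b₁ := fun x y h ↦ funext fun i ↦ congrFun h (i + 1)
    have hinj₂ : Function.Injective b₂ := fun x y h ↦ funext fun i ↦ congrFun h (i + 1)
    have htail : ∀ x ∈ E, ∀ y ∈ E, ∀ u v, x ≠ y →
        ∃ i < n + 1, ‖ζ - 1‖ * r ≤ dist (cons u x i) (cons v y i) := by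
      intro x hx y hy u v hxy
      obtain ⟨i, hi, h⟩ := hEsep x hx y hy hxy
      exact ⟨i + 1, by omega, h⟩
    have hhead : ∀ x ∈ E, ∀ y ∈ E,
        ∃ i < n + 1, ‖ζ - 1‖ * r ≤ dist (b₁ x i) (b₂ y i) := by
      intro x hx y hy
      by_cases hxy : x = y
      · subst hxy
        exact ⟨0, by omega, hsep _ (hE x hx).2⟩
      · exact htail x hx y hy _ _ hxy
    have hdisj : Disjoint (E.image b₁) (E.image b₂) := by
      rw [Finset.disjoint_left]
      rintro z hz₁ hz₂
      obtain ⟨x, hx, rfl⟩ := Finset.mem_image.1 hz₁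
      obtain ⟨y, hy, hxy⟩ := Finset.mem_image.1 hz₂
      obtain ⟨i, -, hi⟩ := hhead x hx y hy
      rw [hxy, dist_self] at hi
      linarith
    refine ⟨E.image b₁ ∪ E.image b₂, ?_, ?_, ?_⟩
    · rw [Finset.card_union_of_disjoint hdisj, Finset.card_image_of_injective _ hinj₁,
        Finset.card_image_of_injective _ hinj₂, hcard, pow_succ]
      ring
    · intro x hx
      rcases Finset.mem_union.1 hx with hx | hx <;> obtain ⟨y, hy, rfl⟩ := Finset.mem_image.1 hx
      · exact hcons y (hE y hy).1 (hE y hy).2 _ (hs _)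
      · exact hcons y (hE y hy).1 (hE y hy).2 _ (hs' _)
    · intro x hx y hy hxy
      rcases Finset.mem_union.1 hx with hx | hx <;> rcases Finset.mem_union.1 hy with hy | hy <;>
        obtain ⟨x', hx', rfl⟩ := Finset.mem_image.1 hx <;>
        obtain ⟨y', hy', rfl⟩ := Finset.mem_image.1 hy
      · exact htail x' hx' y' hy' _ _ fun h ↦ hxy (by rw [h])
      · exact hhead x' hx' y' hy'
      · obtain ⟨i, hi, h⟩ := hhead y' hy' x' hx'
        exact ⟨i, hi, by rwa [dist_comm]⟩
      · exact htail x' hx' y' hy' _ _ fun h ↦ hxy (by rw [h])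

end IsTrapping

end Correspondence

/-! ### General facts on pressure and its zero. -/

section Pressure

variable {X : Type*} [UniformSpace X]

/-- Comparison of the pressures of two potentials whose Birkhoff sums are comparable. -/
theorem topologicalPressure_le_add {T : X → X} {F : Set X} {φ ψ : X → ℝ} {a b : ℝ}
    (h : ∀ x ∈ F, ∀ n : ℕ, birkhoffSum T φ n x ≤ birkhoffSum T ψ n x + (a * n + b)) :
    topologicalPressure T F φ ≤ topologicalPressure T F ψ + a := by
  refine iSup₂_le fun U hU ↦ ?_
  set v : ℕ → ENNReal := fun n ↦ ⨆ (E : Finset X)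
    (_ : Dynamics.IsDynNetIn T F U n (E : Set X)),
      ∑ x ∈ E, ENNReal.ofReal (Real.exp (birkhoffSum T ψ n x)) with hv
  -- The factor `exp (a * n)` contributes exactly `a` to the growth rate, while the constant `exp b`
  -- contributes nothing.
  set w : ℕ → ENNReal := fun n ↦ EReal.exp ((a : EReal) * n) with hw
  have hle : ∀ n : ℕ, (⨆ (E : Finset X) (_ : Dynamics.IsDynNetIn T F U n (E : Set X)),
      ∑ x ∈ E, ENNReal.ofReal (Real.exp (birkhoffSum T φ n x))) ≤
        ENNReal.ofReal (Real.exp b) * (w * v) n := by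
    intro n
    refine iSup₂_le fun E hE ↦ ?_
    have hwn : w n = ENNReal.ofReal (Real.exp (a * n)) := by
      have : (a : EReal) * n = ((a * n : ℝ) : EReal) := by push_cast; rfl
      simp only [hw, this, EReal.exp_coe]
    calc ∑ x ∈ E, ENNReal.ofReal (Real.exp (birkhoffSum T φ n x))
        ≤ ∑ x ∈ E, ENNReal.ofReal (Real.exp b) *
            (w n * ENNReal.ofReal (Real.exp (birkhoffSum T ψ n x))) := by
          refine Finset.sum_le_sum fun x hx ↦ ?_
          rw [hwn, ← ENNReal.ofReal_mul (Real.exp_pos _).le,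
            ← ENNReal.ofReal_mul (Real.exp_pos _).le, ← Real.exp_add, ← Real.exp_add]
          refine ENNReal.ofReal_le_ofReal (Real.exp_le_exp.2 ?_)
          linarith [h x (hE.1 hx) n]
      _ = ENNReal.ofReal (Real.exp b) *
            (w n * ∑ x ∈ E, ENNReal.ofReal (Real.exp (birkhoffSum T ψ n x))) := by
          rw [← Finset.mul_sum, ← Finset.mul_sum]
      _ ≤ _ := by
          simp only [Pi.mul_apply]
          gcongr
          exact le_iSup₂_of_le E hE le_rfl
  refine (ExpGrowth.expGrowthSup_le_of_eventually_le ENNReal.ofReal_ne_top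
    (Eventually.of_forall hle)).trans ?_
  have hgw : ExpGrowth.expGrowthSup w = a := ExpGrowth.expGrowthSup_exp
  refine (ExpGrowth.expGrowthSup_mul_le (Or.inl ?_) (Or.inl ?_)).trans ?_
  · rw [hgw]; exact EReal.coe_ne_bot a
  · rw [hgw]; exact EReal.coe_ne_top a
  · rw [hgw, add_comm]
    gcongr
    exact le_iSup₂_of_le (f := fun U (_ : U ∈ 𝓤 X) ↦ ExpGrowth.expGrowthSup fun n : ℕ ↦
      ⨆ (E : Finset X) (_ : Dynamics.IsDynNetIn T F U n (E : Set X)),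
        ∑ x ∈ E, ENNReal.ofReal (Real.exp (birkhoffSum T ψ n x))) U hU le_rfl

/-- A positive function that decreases at a definite rate, but not too fast, has a unique zero. -/
theorem exists_unique_zero_of_le_add {f : ℝ → EReal} {α β : ℝ} (hα : 0 < α) (h0 : 0 < f 0)
    (htop : f 0 < ⊤) (h1 : ∀ s t, 0 ≤ s → s ≤ t → f t ≤ f s + (-(α * (t - s)) : ℝ))
    (h2 : ∀ s t, 0 ≤ s → s ≤ t → f s ≤ f t + (β * (t - s) : ℝ)) :
    ∃ t : ℝ, 0 < t ∧ (∀ s, 0 ≤ s → (f s = 0 ↔ s = t)) ∧ ∀ s, t < s → f s < 0 := by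
  have hne_top : ∀ s, 0 ≤ s → f s ≠ ⊤ := by
    intro s hs h
    have := h1 0 s le_rfl hs
    rw [h, top_le_iff] at this
    exact (EReal.add_lt_top htop.ne (EReal.coe_ne_top _)).ne this
  have hne_bot : ∀ s, 0 ≤ s → f s ≠ ⊥ := by
    intro s hs h
    have := h2 0 s le_rfl hs
    rw [h, EReal.bot_add] at this
    exact (h0.trans_le this).not_ge bot_le
  set g : ℝ → ℝ := fun s ↦ (f s).toReal with hg
  have hfg : ∀ s, 0 ≤ s → f s = (g s : EReal) := fun s hs ↦
    (EReal.coe_toReal (hne_top s hs) (hne_bot s hs)).symm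
  have g1 : ∀ s t, 0 ≤ s → s ≤ t → g t ≤ g s - α * (t - s) := by
    intro s t hs hst
    have := h1 s t hs hst
    rw [hfg s hs, hfg t (hs.trans hst), ← EReal.coe_add, EReal.coe_le_coe_iff] at this
    linarith
  have g2 : ∀ s t, 0 ≤ s → s ≤ t → g s ≤ g t + β * (t - s) := by
    intro s t hs hst
    have := h2 s t hs hst
    rwa [hfg s hs, hfg t (hs.trans hst), ← EReal.coe_add, EReal.coe_le_coe_iff] at this
  have hg0 : 0 < g 0 := by
    rw [hfg 0 le_rfl] at h0
    exact_mod_cast h0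
  have hβ : 0 ≤ β := by
    have e1 := g1 0 1 le_rfl zero_le_one
    have e2 := g2 0 1 le_rfl zero_le_one
    linarith
  have hlip : ∀ s t, 0 ≤ s → 0 ≤ t → |g s - g t| ≤ β * |s - t| := by
    have key : ∀ s t, 0 ≤ s → s ≤ t → |g s - g t| ≤ β * |s - t| := by
      intro s t hs hst
      have e1 := g1 s t hs hst
      have e2 := g2 s t hs hst
      have e3 : 0 ≤ α * (t - s) := mul_nonneg hα.le (sub_nonneg.2 hst)
      rw [abs_of_nonneg (by linarith), abs_of_nonpos (by linarith)]
      linarith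
    intro s t hs ht
    rcases le_total s t with h | h
    · exact key s t hs h
    · rw [abs_sub_comm, abs_sub_comm s]
      exact key t s ht h
  have hcont : ContinuousOn g (Set.Ici 0) := by
    refine (LipschitzOnWith.of_dist_le_mul (K := β.toNNReal) fun s hs t ht ↦ ?_).continuousOn
    rw [Real.coe_toNNReal _ hβ, Real.dist_eq, Real.dist_eq]
    exact hlip s t hs ht
  -- At `b` the guaranteed rate of decrease `α` has used up the initial value `g 0`.
  set b := g 0 / α with hb
  have hbpos : 0 < b := div_pos hg0 hα
  have hgb : g b ≤ 0 := by
    have := g1 0 b le_rfl hbpos.le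
    have e : α * (b - 0) = g 0 := by rw [hb]; field_simp; ring
    linarith
  obtain ⟨t, ⟨ht0, -⟩, ht⟩ := intermediate_value_Icc' hbpos.le
    (hcont.mono fun s hs ↦ hs.1) (show (0 : ℝ) ∈ Set.Icc (g b) (g 0) from ⟨hgb, hg0.le⟩)
  have htpos : 0 < t := lt_of_le_of_ne ht0 (by rintro rfl; exact hg0.ne' ht)
  refine ⟨t, htpos, fun s hs ↦ ⟨fun h ↦ ?_, ?_⟩, fun s hs ↦ ?_⟩
  · rw [hfg s hs] at h
    have hgs : g s = 0 := by exact_mod_cast h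
    rcases lt_trichotomy s t with hst | hst | hst
    · have := g1 s t hs hst.le
      nlinarith [mul_pos hα (sub_pos.2 hst)]
    · exact hst
    · have := g1 t s ht0 hst.le
      nlinarith [mul_pos hα (sub_pos.2 hst)]
  · rintro rfl
    rw [hfg s hs, ht]
    rfl
  · have := g1 t s ht0 hs.le
    have e := mul_pos hα (sub_pos.2 hs)
    rw [hfg s (ht0.trans hs.le)]
    exact_mod_cast (show g s < 0 by linarith)

end Pressure

/-! ### The shift on the orbit space and the pressure at zero. -/

namespace Correspondence

open Metric

variable {p q : ℕ} {c : ℂ} {U : Set ℂ} {ε R : ℝ}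

theorem shift_iterate_apply (k : ℕ) (x : ℕ → ℂ) (i : ℕ) : shift^[k] x i = x (i + k) := by
  induction k generalizing x with
  | zero => rfl
  | succ k ih =>
    rw [Function.iterate_succ_apply, ih, shift]
    congr 1

theorem shift_iterate_mem_orbitSpace {x : ℕ → ℂ} (hx : x ∈ orbitSpace p q c) (k : ℕ) :
    shift^[k] x ∈ orbitSpace p q c := by
  refine ⟨fun i ↦ ?_, fun i ↦ ?_⟩
  · rw [shift_iterate_apply, shift_iterate_apply, add_right_comm]
    exact hx.1 (i + k)
  · rw [shift_iterate_apply]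
    exact hx.2 _

theorem mapsTo_shift : Set.MapsTo shift (orbitSpace p q c) (orbitSpace p q c) :=
  fun _ hx ↦ shift_iterate_mem_orbitSpace hx 1

/-- The entourage of the pairs of sequences whose initial terms are at distance less than `δ`. -/
def initialEntourage (δ : ℝ) : SetRel (ℕ → ℂ) (ℕ → ℂ) := {x | dist (x.1 0) (x.2 0) < δ}

theorem initialEntourage_mem {δ : ℝ} (hδ : 0 < δ) : initialEntourage δ ∈ 𝓤 (ℕ → ℂ) :=
  Pi.uniformContinuous_proj (fun _ : ℕ ↦ ℂ) 0 (Metric.dist_mem_uniformity hδ)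

theorem mem_ball_dynEntourage_initialEntourage {δ : ℝ} {n : ℕ} {x y : ℕ → ℂ} :
    y ∈ UniformSpace.ball x (Dynamics.dynEntourage shift (initialEntourage δ) n) ↔
      ∀ k < n, dist (x k) (y k) < δ := by
  rw [Dynamics.mem_ball_dynEntourage]
  simp [UniformSpace.ball, initialEntourage, shift_iterate_apply]

/-- Nets are defined by disjoint dynamical balls, so `η`-separation yields a net only for the radius
`η / 2`. -/
theorem isDynNetIn_of_separated {F E : Set (ℕ → ℂ)} {η : ℝ} {n : ℕ} (hE : E ⊆ F)
    (h : ∀ x ∈ E, ∀ y ∈ E, x ≠ y → ∃ i < n, η ≤ dist (x i) (y i)) :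
    Dynamics.IsDynNetIn shift F (initialEntourage (η / 2)) n E := by
  refine ⟨hE, fun x hx y hy hxy ↦ Set.disjoint_left.2 fun u hu₁ hu₂ ↦ ?_⟩
  rw [mem_ball_dynEntourage_initialEntourage] at hu₁ hu₂
  obtain ⟨i, hi, h⟩ := h x hx y hy hxy
  have h1 := hu₁ i hi
  have h2 := hu₂ i hi
  linarith [dist_triangle_right (x i) (y i) (u i)]

theorem exists_dist_lt_of_mem_uniformity {V : SetRel (ℕ → ℂ) (ℕ → ℂ)} (hV : V ∈ 𝓤 (ℕ → ℂ)) :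
    ∃ (k : ℕ) (ρ : ℝ), 0 < ρ ∧ ∀ x y : ℕ → ℂ, (∀ i < k, dist (x i) (y i) < ρ) → (x, y) ∈ V := by
  rw [Pi.uniformity, Filter.mem_iInf'] at hV
  obtain ⟨I, hI, W, hW, -, hVW, -⟩ := hV
  have hρ : ∀ i, ∃ ρ > 0, ∀ x y : ℕ → ℂ, dist (x i) (y i) < ρ → (x, y) ∈ W i := by
    intro i
    obtain ⟨W', hW', hsub⟩ := Filter.mem_comap.1 (hW i)
    obtain ⟨ρ, hρ, hρW⟩ := Metric.mem_uniformity_dist.1 hW'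
    exact ⟨ρ, hρ, fun x y hxy ↦ hsub (hρW hxy)⟩
  choose ρ hρpos hρ using hρ
  obtain ⟨k, hk⟩ := hI.bddAbove
  obtain ⟨i₀, -, hi₀⟩ := Finset.exists_min_image (Finset.range (k + 1)) ρ ⟨0, by simp⟩
  refine ⟨k + 1, ρ i₀, hρpos i₀, fun x y hxy ↦ ?_⟩
  rw [hVW]
  refine Set.mem_iInter₂.2 fun i hi ↦ hρ i x y ?_
  have hik : i < k + 1 := Nat.lt_succ_of_le (hk hi)
  exact (hxy i hik).trans_le (hi₀ i (Finset.mem_range.2 hik))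

/-- The pressure at `0` is positive. -/
theorem IsTrapping.pressureFunction_zero_pos (hT : IsTrapping p q c U ε R) (hp : 2 ≤ p)
    (hq : q ≠ 0) : 0 < pressureFunction p q c 0 := by
  obtain ⟨η, hη, hE⟩ := hT.exists_separated hp hq
  have hlog : (0 : EReal) < ENNReal.log 2 := ENNReal.zero_lt_log_iff.2 (by norm_num)
  refine hlog.trans_le ?_
  rw [← ExpGrowth.expGrowthSup_pow (b := 2)]
  refine le_iSup₂_of_le (initialEntourage (η / 2)) (initialEntourage_mem (half_pos hη)) ?_
  refine ExpGrowth.expGrowthSup_monotone fun n ↦ ?_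
  obtain ⟨E, hcard, hEX, hsep⟩ := hE n
  refine le_iSup₂_of_le E (isDynNetIn_of_separated hEX hsep) ?_
  simp [birkhoffSum, hcard]

/-- Forward branches through nearby points almost expand by the modulus of the derivative. -/
theorem IsTrapping.exists_branch_estimate (hT : IsTrapping p q c U ε R) (hp : p ≠ 0) (hq : q ≠ 0)
    {η : ℝ} (hη : 0 < η) : ∃ δ > 0, ∀ z ∈ juliaSet p q c, ∀ w ∈ juliaSet p q c, ∀ z' w' : ℂ,
      IsImage p q c z w → IsImage p q c z' w' → dist z z' < δ → dist w w' < δ →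
        dist z z' * ‖branchDeriv p q c z w‖ ≤ Real.exp η * dist w w' := by
  have hp' : (p : ℂ) ≠ 0 := by exact_mod_cast hp
  have hq' : (q : ℂ) ≠ 0 := by exact_mod_cast hq
  obtain ⟨r, hr, hrJ⟩ := hT.exists_le_norm hp hq
  set S : ℕ → ℂ → ℂ → ℂ := fun n x y ↦ ∑ i ∈ Finset.range n, x ^ i * y ^ (n - 1 - i) with hS
  have hSmul : ∀ n x y, S n x y * (x - y) = x ^ n - y ^ n := fun n x y ↦
    (Commute.all x y).geom_sum₂_mul n
  have hSdiag : ∀ n x, S n x x * x = n * x ^ n := by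
    intro n x
    simp only [hS, Finset.sum_mul]
    rw [Finset.sum_congr rfl (g := fun _ ↦ x ^ n)]
    · simp
    · intro i hi
      have := Finset.mem_range.1 hi
      rw [← pow_add, ← pow_succ]
      congr 1
      omega
  set Γ : Set (ℂ × ℂ) := (juliaSet p q c ×ˢ juliaSet p q c) ∩ {v | IsImage p q c v.1 v.2} with hΓ
  have hΓc : IsCompact Γ :=
    (hT.isCompact_juliaSet.prod hT.isCompact_juliaSet).inter_right (isClosed_isImage p q c)
  -- `O` is the cross-multiplied comparison of difference quotients. On the diagonal both sides,
  -- apart from `exp η`, equal `p * q * ‖z‖ ^ p`, so the strict inequality holds there, and by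
  -- compactness of `Γ` on a uniform neighbourhood.
  set O : Set ((ℂ × ℂ) × (ℂ × ℂ)) := {v | ‖p * (v.1.2 - c)‖ * ‖S q (v.2.2 - c) (v.1.2 - c)‖ <
    Real.exp η * (‖q * v.1.1‖ * ‖S p v.2.1 v.1.1‖)} with hO
  have hOopen : IsOpen O := isOpen_lt (by fun_prop) (by fun_prop)
  have hsub : (fun v ↦ (v, v)) '' Γ ⊆ O := by
    rintro _ ⟨⟨z, w⟩, ⟨⟨hz, -⟩, hzw⟩, rfl⟩
    have hzw : (w - c) ^ q = z ^ p := hzw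
    have hz0 : 0 < ‖z‖ := hr.trans_le (hrJ z hz)
    have h1 : ‖p * (w - c)‖ * ‖S q (w - c) (w - c)‖ = p * q * ‖z‖ ^ p := by
      rw [norm_mul, mul_assoc, mul_comm ‖w - c‖, ← norm_mul, hSdiag, hzw, norm_mul, norm_pow]
      simp [mul_assoc]
    have h2 : ‖q * z‖ * ‖S p z z‖ = p * q * ‖z‖ ^ p := by
      rw [norm_mul, mul_assoc, mul_comm ‖z‖, ← norm_mul, hSdiag, norm_mul, norm_pow]
      simp only [Complex.norm_natCast]
      ring
    change ‖p * (w - c)‖ * ‖S q (w - c) (w - c)‖ < Real.exp η * (‖q * z‖ * ‖S p z z‖)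
    rw [h1, h2]
    have : (0 : ℝ) < p * q * ‖z‖ ^ p := by positivity
    exact lt_mul_of_one_lt_left this (Real.one_lt_exp_iff.2 hη)
  obtain ⟨δ, hδ, hthick⟩ :=
    (hΓc.image (by fun_prop : Continuous fun v : ℂ × ℂ ↦ (v, v))).exists_thickening_subset_open
      hOopen hsub
  refine ⟨δ, hδ, fun z hz w hw z' w' hzw hzw' hdz hdw ↦ ?_⟩
  have hmem : (((z, w), (z', w')) : (ℂ × ℂ) × (ℂ × ℂ)) ∈ O := by
    refine hthick (mem_thickening_iff.2 ⟨((z, w), (z, w)), ⟨(z, w), ⟨⟨hz, hw⟩, hzw⟩, rfl⟩, ?_⟩)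
    simp [Prod.dist_eq, dist_comm z', dist_comm w', hdz, hdw]
  have hmem : ‖p * (w - c)‖ * ‖S q (w' - c) (w - c)‖ <
    Real.exp η * (‖q * z‖ * ‖S p z' z‖) := hmem
  have hz0 : 0 < ‖z‖ := hr.trans_le (hrJ z hz)
  have hqz : 0 < ‖(q : ℂ) * z‖ := norm_pos_iff.2 (mul_ne_zero hq' (norm_pos_iff.1 hz0))
  have hSp : 0 < ‖S p z' z‖ := by
    by_contra! h
    have h0 : ‖S p z' z‖ = 0 := le_antisymm h (norm_nonneg _)
    rw [h0] at hmem
    have : 0 ≤ ‖p * (w - c)‖ * ‖S q (w' - c) (w - c)‖ := by positivity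
    linarith
  have heq : ‖S q (w' - c) (w - c)‖ * dist w w' = ‖S p z' z‖ * dist z z' := by
    rw [dist_comm w, dist_comm z, dist_eq_norm, dist_eq_norm, ← norm_mul, ← norm_mul, hSmul]
    have := hSmul q (w' - c) (w - c)
    rw [sub_sub_sub_cancel_right] at this
    rw [this, hzw, hzw']
  rw [branchDeriv, norm_div, mul_div_assoc', div_le_iff₀ hqz]
  refine le_of_mul_le_mul_right ?_ hSp
  calc dist z z' * ‖p * (w - c)‖ * ‖S p z' z‖
      = ‖p * (w - c)‖ * ‖S q (w' - c) (w - c)‖ * dist w w' := by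
        rw [mul_assoc _ ‖S q _ _‖, heq]; ring
    _ ≤ Real.exp η * (‖q * z‖ * ‖S p z' z‖) * dist w w' := by gcongr
    _ = Real.exp η * dist w w' * ‖q * z‖ * ‖S p z' z‖ := by ring

/-- Backward contraction along orbits in the Julia set that stay close to each other. -/
theorem IsTrapping.exists_orbit_estimate (hT : IsTrapping p q c U ε R) (hp : p ≠ 0) (hq : q ≠ 0)
    {η : ℝ} (hη : 0 < η) : ∃ δ > 0, ∀ x ∈ orbitSpace p q c, ∀ y ∈ orbitSpace p q c, ∀ n : ℕ,
      (∀ i ≤ n, dist (x i) (y i) < δ) →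
        dist (x 0) (y 0) * ‖∏ i ∈ Finset.range n, branchDeriv p q c (x i) (x (i + 1))‖ ≤
          Real.exp (η * n) * δ := by
  obtain ⟨δ, hδ, h⟩ := hT.exists_branch_estimate hp hq hη
  refine ⟨δ, hδ, fun x hx y hy n hn ↦ ?_⟩
  suffices hs : dist (x 0) (y 0) *
      ‖∏ i ∈ Finset.range n, branchDeriv p q c (x i) (x (i + 1))‖ ≤
        Real.exp (η * n) * dist (x n) (y n) by
    refine hs.trans ?_
    gcongr
    exact (hn n le_rfl).le
  induction n with
  | zero => simp
  | succ n ih =>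
    have h1 := ih fun i hi ↦ hn i (by omega)
    have h2 := h (x n) (hx.2 n) (x (n + 1)) (hx.2 _) (y n) (y (n + 1)) (hx.1 n) (hy.1 n)
      (hn n (by omega)) (hn (n + 1) le_rfl)
    rw [Finset.prod_range_succ, norm_mul, ← mul_assoc]
    calc _ ≤ Real.exp (η * n) * dist (x n) (y n) * ‖branchDeriv p q c (x n) (x (n + 1))‖ := by
          gcongr
      _ = Real.exp (η * n) * (dist (x n) (y n) * ‖branchDeriv p q c (x n) (x (n + 1))‖) := by
          ring
      _ ≤ Real.exp (η * n) * (Real.exp η * dist (x (n + 1)) (y (n + 1))) := by gcongr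
      _ = Real.exp (η * (n + 1 : ℕ)) * dist (x (n + 1)) (y (n + 1)) := by
          rw [← mul_assoc, ← Real.exp_add]
          push_cast
          ring_nf

theorem IsTrapping.le_norm_prod_of_mem_orbitSpace (hT : IsTrapping p q c U ε R) (hp : p ≠ 0)
    (hq : q ≠ 0) {x : ℕ → ℂ} (hx : x ∈ orbitSpace p q c) (n : ℕ) :
    ε / R * (1 + ε / R) ^ n ≤
      ‖∏ i ∈ Finset.range n, branchDeriv p q c (x i) (x (i + 1))‖ :=
  hT.le_norm_prod_branchDeriv hp hq hT.eps_pos n x (fun i _ ↦ hx.1 i)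
    (hT.ball_subset_of_mem_closure (hT.juliaSet_subset (hx.2 n)))

/-- The shift on the orbit space is expansive, uniformly. -/
theorem IsTrapping.exists_expansive (hT : IsTrapping p q c U ε R) (hp : p ≠ 0) (hq : q ≠ 0) :
    ∃ δ > 0, ∀ ρ > 0, ∃ m : ℕ, ∀ x ∈ orbitSpace p q c, ∀ y ∈ orbitSpace p q c,
      (∀ i ≤ m, dist (x i) (y i) < δ) → dist (x 0) (y 0) < ρ := by
  have hL : 0 < Real.log (1 + ε / R) := Real.log_pos hT.one_lt
  -- With half the expansion rate as error, the expansion `exp (2 * η * m)` beats the distortion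
  -- `exp (η * m)` and leaves a contraction by `exp (-η * m)`.
  set η := Real.log (1 + ε / R) / 2 with hηdef
  have hη : 0 < η := half_pos hL
  obtain ⟨δ, hδ, h⟩ := hT.exists_orbit_estimate hp hq hη
  have hC : 0 < ε / R := div_pos hT.eps_pos hT.R_pos
  refine ⟨δ, hδ, fun ρ hρ ↦ ?_⟩
  obtain ⟨m, hm⟩ := pow_unbounded_of_one_lt (δ / (ε / R * ρ)) (Real.one_lt_exp_iff.2 hη)
  refine ⟨m, fun x hx y hy hxy ↦ ?_⟩
  have h1 := h x hx y hy m hxy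
  have h2 := hT.le_norm_prod_of_mem_orbitSpace hp hq hx m
  have h3 : (1 + ε / R) ^ m = Real.exp (η * m) * Real.exp (η * m) := by
    rw [← Real.exp_add, ← Real.exp_log (pow_pos (zero_lt_one.trans hT.one_lt) m), Real.log_pow]
    congr 1
    rw [hηdef]
    ring
  have h4 : Real.exp η ^ m = Real.exp (η * m) := by rw [← Real.exp_nat_mul, mul_comm]
  rw [h4, div_lt_iff₀ (by positivity)] at hm
  have hE := Real.exp_pos (η * m)
  have h5 : dist (x 0) (y 0) * (ε / R * (Real.exp (η * m) * Real.exp (η * m))) ≤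
      Real.exp (η * m) * δ := by
    rw [← h3]
    exact (mul_le_mul_of_nonneg_left h2 dist_nonneg).trans h1
  have h6 : dist (x 0) (y 0) * (ε / R * Real.exp (η * m)) ≤ δ := by
    refine le_of_mul_le_mul_left ?_ hE
    linarith
  by_contra! hge
  have h7 : ρ * (ε / R * Real.exp (η * m)) ≤ dist (x 0) (y 0) * (ε / R * Real.exp (η * m)) := by
    gcongr
  linarith

/-- The pressure at `0` is finite. -/
theorem IsTrapping.pressureFunction_zero_lt_top (hT : IsTrapping p q c U ε R) (hp : p ≠ 0)
    (hq : q ≠ 0) : pressureFunction p q c 0 < ⊤ := by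
  obtain ⟨δ, hδ, hexp⟩ := hT.exists_expansive hp hq
  set U₀ := initialEntourage (δ / 2) with hU₀
  have hU₀mem : U₀ ∈ 𝓤 (ℕ → ℂ) := initialEntourage_mem (half_pos hδ)
  have hU₀symm : U₀.IsSymm := ⟨fun x y h ↦ by
    change dist (y 0) (x 0) < δ / 2
    rw [dist_comm]
    exact h⟩
  have hfin : Dynamics.netEntropyEntourage shift (orbitSpace p q c) U₀ < ⊤ :=
    (Dynamics.netEntropyEntourage_le_coverEntropyEntourage _ _).trans_lt
      (Dynamics.coverEntropyEntourage_finite_of_isCompact_invariant hT.isCompact_orbitSpace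
        mapsTo_shift hU₀mem)
  have hzero : pressureFunction p q c 0 = Dynamics.coverEntropy shift (orbitSpace p q c) := by
    rw [← topologicalPressure_zero]
    simp [pressureFunction]
  rw [hzero, Dynamics.coverEntropy_eq_iSup_netEntropyEntourage]
  have hbound : (⨆ V ∈ 𝓤 (ℕ → ℂ), Dynamics.netEntropyEntourage shift (orbitSpace p q c) V) ≤
      ((2 : ℕ) : EReal) * Dynamics.netEntropyEntourage shift (orbitSpace p q c) U₀ := by
    refine iSup₂_le fun V hV ↦ ?_
    obtain ⟨k, ρ, hρ, hkV⟩ := exists_dist_lt_of_mem_uniformity hV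
    obtain ⟨m, hm⟩ := hexp ρ hρ
    have hmono : Monotone fun n ↦
        ((Dynamics.netMaxcard shift (orbitSpace p q c) U₀ n : ℕ∞) : ENNReal) :=
      fun i j hij ↦ ENat.toENNReal_mono (Dynamics.netMaxcard_monotone_time _ _ _ hij)
    unfold Dynamics.netEntropyEntourage
    -- Time `2 * n` at the fixed scale controls time `n` at the scale `V` once `n ≥ k + m`: the last
    -- `m` steps are spent on expansivity and `k` on the coordinates seen by `V`. The price is only
    -- the factor `2`.
    rw [← hmono.expGrowthSup_comp_mul two_ne_zero]
    refine ExpGrowth.expGrowthSup_eventually_monotone ?_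
    filter_upwards [eventually_ge_atTop (k + m)] with n hn
    refine ENat.toENNReal_mono (iSup₂_le fun E hE ↦ ?_)
    refine Dynamics.IsDynNetIn.card_le_netMaxcard ⟨hE.1, fun x hx y hy hxy ↦ ?_⟩
    refine Set.disjoint_left.2 fun u hu₁ hu₂ ↦ ?_
    rw [mem_ball_dynEntourage_initialEntourage] at hu₁ hu₂
    have hclose : ∀ i < 2 * n, dist (x i) (y i) < δ := by
      intro i hi
      have h1 := hu₁ i hi
      have h2 := hu₂ i hi
      linarith [dist_triangle_right (x i) (y i) (u i)]
    have hρclose : ∀ i < n + k, dist (x i) (y i) < ρ := by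
      intro i hi
      have := hm _ (shift_iterate_mem_orbitSpace (hE.1 hx) i) _
        (shift_iterate_mem_orbitSpace (hE.1 hy) i) fun j hj ↦ by
          rw [shift_iterate_apply, shift_iterate_apply]
          exact hclose _ (by omega)
      simpa [shift_iterate_apply] using this
    have hdisj := Set.disjoint_left.1 (hE.2 hx hy hxy)
    refine @hdisj y ?_ ?_
    · rw [Dynamics.mem_ball_dynEntourage]
      intro j hj
      refine hkV _ _ fun i hi ↦ ?_
      rw [shift_iterate_apply, shift_iterate_apply]
      exact hρclose _ (by omega)
    · rw [Dynamics.mem_ball_dynEntourage]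
      exact fun j _ ↦ UniformSpace.mem_ball_self _ hV
  refine hbound.trans_lt (lt_top_iff_ne_top.2 ?_)
  refine EReal.mul_ne_top _ _ |>.2 ⟨Or.inl (EReal.coe_ne_bot 2), Or.inl ?_,
    Or.inl (EReal.coe_ne_top 2), Or.inr hfin.ne⟩
  exact_mod_cast Nat.zero_le 2


/-! ### Birkhoff sums of the geometric potential and the Bowen parameter. -/

theorem birkhoffSum_const_mul_geometricPotential (t : ℝ) (n : ℕ) (x : ℕ → ℂ) :
    birkhoffSum shift (fun z ↦ t * geometricPotential p q c z) n x =
      t * birkhoffSum shift (geometricPotential p q c) n x := by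
  simp [birkhoffSum, Finset.mul_sum]

theorem IsTrapping.branchDeriv_ne_zero (hT : IsTrapping p q c U ε R) (hp : p ≠ 0) (hq : q ≠ 0)
    {x : ℕ → ℂ} (hx : x ∈ orbitSpace p q c) (i : ℕ) :
    branchDeriv p q c (x i) (x (i + 1)) ≠ 0 := by
  have hU := hT.juliaSet_subset_domain (hx.2 (i + 1))
  have hx0 := hT.ne_zero_of_image hp hq (hx.1 i) hU
  have hw : x (i + 1) - c ≠ 0 := sub_ne_zero.2 fun h ↦ hT.critical (h ▸ hU)
  exact div_ne_zero (mul_ne_zero (by exact_mod_cast hp) hw) (mul_ne_zero (by exact_mod_cast hq) hx0)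

theorem IsTrapping.birkhoffSum_geometricPotential (hT : IsTrapping p q c U ε R) (hp : p ≠ 0)
    (hq : q ≠ 0) {x : ℕ → ℂ} (hx : x ∈ orbitSpace p q c) (n : ℕ) :
    birkhoffSum shift (geometricPotential p q c) n x =
      -Real.log ‖∏ i ∈ Finset.range n, branchDeriv p q c (x i) (x (i + 1))‖ := by
  rw [norm_prod, Real.log_prod fun i _ ↦ norm_ne_zero_iff.2 (hT.branchDeriv_ne_zero hp hq hx i)]
  simp [birkhoffSum, geometricPotential, shift_iterate_apply, add_comm 1]

/-- Uniform expansion in logarithmic form; it makes the pressure decrease at the rate `log (1 + ε /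
R)`. -/
theorem IsTrapping.birkhoffSum_le (hT : IsTrapping p q c U ε R) (hp : p ≠ 0)
    (hq : q ≠ 0) {x : ℕ → ℂ} (hx : x ∈ orbitSpace p q c) (n : ℕ) :
    birkhoffSum shift (geometricPotential p q c) n x ≤
      -(Real.log (1 + ε / R) * n) - Real.log (ε / R) := by
  rw [hT.birkhoffSum_geometricPotential hp hq hx]
  have hC : 0 < ε / R := div_pos hT.eps_pos hT.R_pos
  have hL : 0 < (1 + ε / R) ^ n := pow_pos (zero_lt_one.trans hT.one_lt) n
  have h := Real.log_le_log (mul_pos hC hL) (hT.le_norm_prod_of_mem_orbitSpace hp hq hx n)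
  rw [Real.log_mul hC.ne' hL.ne', Real.log_pow] at h
  linarith

/-- The derivatives are bounded above since the Julia set is bounded and stays away from `0`. This
gives the lower slope of the pressure function and allows a Birkhoff sum to be lengthened by one
term. -/
theorem IsTrapping.exists_le_birkhoffSum (hT : IsTrapping p q c U ε R) (hp : p ≠ 0)
    (hq : q ≠ 0) : ∃ β : ℝ, (∀ x ∈ orbitSpace p q c, -β ≤ geometricPotential p q c x) ∧
      ∀ x ∈ orbitSpace p q c, ∀ n : ℕ,
        -(β * n) ≤ birkhoffSum shift (geometricPotential p q c) n x := by
  obtain ⟨r, hr, hrJ⟩ := hT.exists_le_norm hp hq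
  obtain ⟨B, hB⟩ := hT.isCompact_juliaSet.isBounded.exists_norm_le
  have hφ : ∀ x ∈ orbitSpace p q c,
      -Real.log (p * (B + ‖c‖) / (q * r)) ≤ geometricPotential p q c x := by
    intro x hx
    have h0 := hT.branchDeriv_ne_zero hp hq hx 0
    rw [geometricPotential, neg_le_neg_iff]
    refine Real.log_le_log (norm_pos_iff.2 h0) ?_
    have hq0 : (0 : ℝ) < q := by exact_mod_cast Nat.pos_of_ne_zero hq
    have h1 : ‖x 1 - c‖ ≤ B + ‖c‖ := (norm_sub_le _ _).trans (by gcongr; exact hB _ (hx.2 1))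
    have h2 := hrJ _ (hx.2 0)
    have h3 : 0 ≤ B + ‖c‖ := (norm_nonneg _).trans h1
    rw [branchDeriv, norm_div, norm_mul, norm_mul, Complex.norm_natCast, Complex.norm_natCast]
    gcongr
  refine ⟨_, hφ, fun x hx n ↦ ?_⟩
  have h : ∑ _i ∈ Finset.range n, -Real.log (p * (B + ‖c‖) / (q * r)) ≤
      birkhoffSum shift (geometricPotential p q c) n x :=
    Finset.sum_le_sum fun i _ ↦ hφ _ (shift_iterate_mem_orbitSpace hx i)
  rw [Finset.sum_const, Finset.card_range, nsmul_eq_mul] at h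
  linarith

/-- The pressure function has a unique zero, and it is negative to the right of the zero. -/
theorem IsTrapping.exists_zero (hT : IsTrapping p q c U ε R) (hp : 2 ≤ p) (hq : q ≠ 0) :
    ∃ t : ℝ, IsBowenParameter p q c t ∧ ∀ s, t < s → pressureFunction p q c s < 0 := by
  have hp0 : p ≠ 0 := by omega
  obtain ⟨β, -, hβ⟩ := hT.exists_le_birkhoffSum hp0 hq
  have hle : ∀ s t, 0 ≤ s → s ≤ t → pressureFunction p q c t ≤
      pressureFunction p q c s + (-(Real.log (1 + ε / R) * (t - s)) : ℝ) := by
    intro s t _ hst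
    refine topologicalPressure_le_add (b := -((t - s) * Real.log (ε / R))) fun x hx n ↦ ?_
    rw [birkhoffSum_const_mul_geometricPotential, birkhoffSum_const_mul_geometricPotential]
    have := mul_le_mul_of_nonneg_left (hT.birkhoffSum_le hp0 hq hx n) (sub_nonneg.2 hst)
    linarith
  have hge : ∀ s t, 0 ≤ s → s ≤ t → pressureFunction p q c s ≤
      pressureFunction p q c t + (β * (t - s) : ℝ) := by
    intro s t _ hst
    refine topologicalPressure_le_add (b := 0) fun x hx n ↦ ?_
    rw [birkhoffSum_const_mul_geometricPotential, birkhoffSum_const_mul_geometricPotential]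
    have := mul_le_mul_of_nonneg_left (hβ x hx n) (sub_nonneg.2 hst)
    linarith
  obtain ⟨t, h1, h2, h3⟩ := exists_unique_zero_of_le_add (Real.log_pos hT.one_lt)
    (hT.pressureFunction_zero_pos hp hq) (hT.pressureFunction_zero_lt_top hp0 hq) hle hge
  exact ⟨t, ⟨h1, h2⟩, h3⟩

/-! ### Covers by dynamical nets and the dimension bound. -/

/-- A finite dynamical net of maximal cardinality covers with twice the radius. -/
theorem exists_isDynNetIn_cover {F : Set (ℕ → ℂ)} (hF : IsCompact F)
    (hinv : Set.MapsTo shift F F) {δ : ℝ} (hδ : 0 < δ) (n : ℕ) :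
    ∃ E : Finset (ℕ → ℂ),
      Dynamics.IsDynNetIn shift F (initialEntourage (δ / 2)) n (E : Set (ℕ → ℂ)) ∧
      ∀ x ∈ F, ∃ e ∈ E, ∀ i < n, dist (e i) (x i) < δ := by
  classical
  have hsymm : (initialEntourage (δ / 2)).IsSymm := ⟨fun x y h ↦ by
    change dist (y 0) (x 0) < δ / 2
    rw [dist_comm]
    exact h⟩
  have hfin : Dynamics.netMaxcard shift F (initialEntourage (δ / 2)) n < ⊤ :=
    (Dynamics.netMaxcard_le_coverMincard _ _ _).trans_lt
      (Dynamics.coverMincard_finite_of_isCompact_invariant hF hinv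
        (initialEntourage_mem (half_pos hδ)) n)
  obtain ⟨E, hE, hcard⟩ := (Dynamics.netMaxcard_finite_iff _ _ _ _).1 hfin
  refine ⟨E, hE, fun x hx ↦ ?_⟩
  by_contra! hfar
  have hxE : x ∉ E := by
    intro hxE
    obtain ⟨i, -, hi⟩ := hfar x hxE
    rw [dist_self] at hi
    linarith
  have hnet : Dynamics.IsDynNetIn shift F (initialEntourage (δ / 2)) n
      ((insert x E : Finset (ℕ → ℂ)) : Set (ℕ → ℂ)) := by
    rw [Finset.coe_insert]
    refine ⟨Set.insert_subset hx hE.1, ?_⟩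
    refine hE.2.insert fun e he _ ↦ Set.disjoint_left.2 fun u hu₁ hu₂ ↦ ?_
    rw [mem_ball_dynEntourage_initialEntourage] at hu₁ hu₂
    obtain ⟨i, hi, h⟩ := hfar e he
    have h1 := hu₁ i hi
    have h2 := hu₂ i hi
    linarith [dist_triangle_right (e i) (x i) (u i)]
  have hle := hnet.card_le_netMaxcard
  rw [Finset.card_insert_of_notMem hxE, ← hcard] at hle
  have : E.card + 1 ≤ E.card := by exact_mod_cast hle
  omega

/-- If the pressure at `t` is negative, then `t` bounds the dimension of the Julia set. -/
theorem IsTrapping.dimH_le (hT : IsTrapping p q c U ε R) (hp : p ≠ 0) (hq : q ≠ 0) {t : ℝ}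
    (ht : 0 < t) (hneg : pressureFunction p q c t < 0) :
    dimH (juliaSet p q c) ≤ ENNReal.ofReal t := by
  obtain ⟨b', hb', hb'0⟩ := EReal.lt_iff_exists_real_btwn.1 hneg
  obtain ⟨b, rfl⟩ : ∃ b, b' = -b := ⟨-b', by ring⟩
  have hb : 0 < b := by
    have : -b < 0 := by exact_mod_cast hb'0
    linarith
  have hL : 0 < Real.log (1 + ε / R) := Real.log_pos hT.one_lt
  -- The first bound lets the distortion `exp (t * η * n)` cost at most half of the decay `exp (-b *
  -- n)`; the second makes the diameters shrink like `exp (-η * n)`.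
  set η := min (b / (2 * t)) (Real.log (1 + ε / R) / 2) with hηdef
  have hη : 0 < η := lt_min (by positivity) (half_pos hL)
  have hη1 : t * η ≤ b / 2 := by
    have := mul_le_mul_of_nonneg_left (min_le_left (b / (2 * t)) (Real.log (1 + ε / R) / 2)) ht.le
    have e : t * (b / (2 * t)) = b / 2 := by field_simp
    linarith
  have hη2 : 2 * η ≤ Real.log (1 + ε / R) := by
    have := min_le_right (b / (2 * t)) (Real.log (1 + ε / R) / 2)
    linarith
  obtain ⟨δ, hδ, hest⟩ := hT.exists_orbit_estimate hp hq hη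
  obtain ⟨β, hβ, -⟩ := hT.exists_le_birkhoffSum hp hq
  -- Nets are taken at time `n + 1` because the orbit estimate over `n` steps needs closeness at all
  -- times `i ≤ n`.
  choose E hEnet hEcov using fun n : ℕ ↦
    exists_isDynNetIn_cover hT.isCompact_orbitSpace mapsTo_shift hδ (n + 1)
  set S : ℕ → (ℕ → ℂ) → ℝ := fun n x ↦ birkhoffSum shift (geometricPotential p q c) n x with hS
  set D : ∀ n : ℕ, E n → Set ℂ := fun n e ↦
    {z | ∃ x ∈ orbitSpace p q c, x 0 = z ∧ ∀ i < n + 1, dist (e.1 i) (x i) < δ} with hD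
  have hdist : ∀ n (e : E n), ∀ z ∈ D n e,
      dist (e.1 0) z ≤ δ * Real.exp (η * n + S n e.1) := by
    rintro n e z ⟨x, hx, rfl, hclose⟩
    have heX := (hEnet n).1 e.2
    have h := hest e.1 heX x hx n fun i hi ↦ hclose i (by omega)
    have hpos : 0 < ‖∏ i ∈ Finset.range n, branchDeriv p q c (e.1 i) (e.1 (i + 1))‖ :=
      norm_pos_iff.2 (Finset.prod_ne_zero_iff.2 fun i _ ↦ hT.branchDeriv_ne_zero hp hq heX i)
    rw [← le_div_iff₀ hpos] at h
    refine h.trans (le_of_eq ?_)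
    rw [Real.exp_add]
    simp only [hS]
    rw [hT.birkhoffSum_geometricPotential hp hq heX, Real.exp_neg, Real.exp_log hpos]
    ring
  have hdiam : ∀ n (e : E n),
      ediam (D n e) ≤ ENNReal.ofReal (2 * δ * Real.exp (η * n + S n e.1)) := by
    intro n e
    refine ediam_le_of_forall_dist_le fun z hz w hw ↦ ?_
    have h1 := hdist n e z hz
    have h2 := hdist n e w hw
    linarith [dist_triangle_left z w (e.1 0)]
  have hmeas : MeasureTheory.Measure.hausdorffMeasure t (juliaSet p q c) ≤
      liminf (fun n ↦ ∑ e : E n, ediam (D n e) ^ t) atTop := by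
    refine MeasureTheory.Measure.hausdorffMeasure_le_liminf_sum t _
      (fun n : ℕ ↦ ENNReal.ofReal (2 * δ * Real.exp (-Real.log (ε / R)) * Real.exp (-η) ^ n))
      ?_ D (Eventually.of_forall fun n e ↦ (hdiam n e).trans (ENNReal.ofReal_le_ofReal ?_))
      (Eventually.of_forall fun n z hz ↦ ?_)
    · have := (tendsto_pow_atTop_nhds_zero_of_lt_one (Real.exp_pos (-η)).le
        (Real.exp_lt_one_iff.2 (by linarith : -η < 0))).const_mul
          (2 * δ * Real.exp (-Real.log (ε / R)))
      rw [mul_zero] at this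
      simpa using ENNReal.tendsto_ofReal this
    · rw [← Real.exp_nat_mul, mul_assoc (2 * δ), ← Real.exp_add]
      refine mul_le_mul_of_nonneg_left (Real.exp_le_exp.2 ?_) (by positivity)
      have h1 : S n e.1 ≤ _ := hT.birkhoffSum_le hp hq ((hEnet n).1 e.2) n
      have h2 : 2 * η * n ≤ Real.log (1 + ε / R) * n := by gcongr
      linarith
    · obtain ⟨x, hx, rfl⟩ := hT.exists_mem_orbitSpace hz
      obtain ⟨e, he, hclose⟩ := hEcov n x hx
      exact Set.mem_iUnion.2 ⟨⟨e, he⟩, x, hx, rfl, hclose⟩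
  have hZ : ∀ᶠ n : ℕ in atTop, (∑ e ∈ E n, ENNReal.ofReal (Real.exp (t * S (n + 1) e))) ≤
      ENNReal.ofReal (Real.exp (-b * (n + 1 : ℕ))) := by
    have hle : (ExpGrowth.expGrowthSup fun n : ℕ ↦ ⨆ (E : Finset (ℕ → ℂ))
        (_ : Dynamics.IsDynNetIn shift (orbitSpace p q c) (initialEntourage (δ / 2)) n
          (E : Set (ℕ → ℂ))), ∑ x ∈ E, ENNReal.ofReal (Real.exp
            (birkhoffSum shift (fun z ↦ t * geometricPotential p q c z) n x))) <
          ((-b : ℝ) : EReal) :=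
      lt_of_le_of_lt (le_iSup₂_of_le (f := fun U (_ : U ∈ 𝓤 (ℕ → ℂ)) ↦
        ExpGrowth.expGrowthSup fun n : ℕ ↦ ⨆ (E : Finset (ℕ → ℂ))
        (_ : Dynamics.IsDynNetIn shift (orbitSpace p q c) U n
          (E : Set (ℕ → ℂ))), ∑ x ∈ E, ENNReal.ofReal (Real.exp
            (birkhoffSum shift (fun z ↦ t * geometricPotential p q c z) n x)))
        _ (initialEntourage_mem (half_pos hδ)) le_rfl) hb'
    have hev := (tendsto_add_atTop_nat 1).eventually (ExpGrowth.eventually_le_exp hle)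
    filter_upwards [hev] with n hn
    have hcast : ((-b : ℝ) : EReal) * ((n + 1 : ℕ) : EReal) = ((-b * (n + 1 : ℕ) : ℝ) : EReal) := by
      rw [EReal.coe_mul]
      rfl
    rw [hcast, EReal.exp_coe] at hn
    refine le_trans ?_ hn
    refine le_iSup₂_of_le (E n) (hEnet n) (le_of_eq ?_)
    refine Finset.sum_congr rfl fun e _ ↦ ?_
    rw [birkhoffSum_const_mul_geometricPotential]
  have hterm : ∀ n (e : E n), ediam (D n e) ^ t ≤
      ENNReal.ofReal ((2 * δ) ^ t * Real.exp (t * β + t * η * n)) *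
        ENNReal.ofReal (Real.exp (t * S (n + 1) e.1)) := by
    intro n e
    -- The diameters involve the sum up to `n`, the pressure at this net the sum up to `n + 1`; the
    -- discrepancy is a constant.
    have hstep : S n e.1 ≤ S (n + 1) e.1 + β := by
      have h1 := hβ _ (shift_iterate_mem_orbitSpace ((hEnet n).1 e.2) n)
      simp only [hS, birkhoffSum_succ]
      linarith
    calc ediam (D n e) ^ t ≤ ENNReal.ofReal (2 * δ * Real.exp (η * n + S n e.1)) ^ t := by
          gcongr
          exact hdiam n e
      _ = ENNReal.ofReal ((2 * δ) ^ t * Real.exp (t * (η * n + S n e.1))) := by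
          rw [ENNReal.ofReal_rpow_of_nonneg (by positivity) ht.le,
            Real.mul_rpow (by positivity) (Real.exp_pos _).le, ← Real.exp_mul, mul_comm t]
      _ ≤ ENNReal.ofReal ((2 * δ) ^ t * Real.exp (t * β + t * η * n + t * S (n + 1) e.1)) := by
          refine ENNReal.ofReal_le_ofReal ?_
          gcongr
          have := mul_le_mul_of_nonneg_left hstep ht.le
          linarith
      _ = _ := by
          rw [← ENNReal.ofReal_mul (by positivity), mul_assoc ((2 * δ) ^ t), ← Real.exp_add]
  have hsum : ∀ᶠ n : ℕ in atTop, ∑ e : E n, ediam (D n e) ^ t ≤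
      ENNReal.ofReal ((2 * δ) ^ t * Real.exp (t * β) * Real.exp (-(b / 2)) ^ n) := by
    filter_upwards [hZ] with n hn
    calc ∑ e : E n, ediam (D n e) ^ t
        ≤ ∑ e : E n, ENNReal.ofReal ((2 * δ) ^ t * Real.exp (t * β + t * η * n)) *
            ENNReal.ofReal (Real.exp (t * S (n + 1) e.1)) :=
          Finset.sum_le_sum fun e _ ↦ hterm n e
      _ = ENNReal.ofReal ((2 * δ) ^ t * Real.exp (t * β + t * η * n)) *
            ∑ e ∈ E n, ENNReal.ofReal (Real.exp (t * S (n + 1) e)) := by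
          rw [← Finset.mul_sum]
          congr 1
          exact Finset.sum_coe_sort (E n) fun e ↦ ENNReal.ofReal (Real.exp (t * S (n + 1) e))
      _ ≤ ENNReal.ofReal ((2 * δ) ^ t * Real.exp (t * β + t * η * n)) *
            ENNReal.ofReal (Real.exp (-b * (n + 1 : ℕ))) := by gcongr
      _ ≤ _ := by
          rw [← ENNReal.ofReal_mul (by positivity)]
          refine ENNReal.ofReal_le_ofReal ?_
          rw [← Real.exp_nat_mul, mul_assoc ((2 * δ) ^ t), mul_assoc ((2 * δ) ^ t),
            ← Real.exp_add, ← Real.exp_add]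
          refine mul_le_mul_of_nonneg_left (Real.exp_le_exp.2 ?_) (by positivity)
          push_cast
          have : t * η * n ≤ b / 2 * n := by gcongr
          linarith
  have hzero : MeasureTheory.Measure.hausdorffMeasure t (juliaSet p q c) ≤ 0 := by
    refine hmeas.trans ?_
    have hlim : Tendsto (fun n : ℕ ↦ ENNReal.ofReal
        ((2 * δ) ^ t * Real.exp (t * β) * Real.exp (-(b / 2)) ^ n)) atTop (𝓝 0) := by
      have := (tendsto_pow_atTop_nhds_zero_of_lt_one (Real.exp_pos (-(b / 2))).le
        (Real.exp_lt_one_iff.2 (by linarith : -(b / 2) < 0))).const_mul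
          ((2 * δ) ^ t * Real.exp (t * β))
      rw [mul_zero] at this
      simpa using ENNReal.tendsto_ofReal this
    rw [← hlim.liminf_eq]
    exact liminf_le_liminf hsum
  have hcoe : ((t.toNNReal : NNReal) : ℝ) = t := Real.coe_toNNReal t ht.le
  refine dimH_le_of_hausdorffMeasure_ne_top (d := t.toNNReal) ?_
  rw [hcoe]
  exact (hzero.trans_lt ENNReal.zero_lt_top).ne

/-- A trapping domain yields the Bowen parameter and the bound on the dimension. -/
theorem IsTrapping.exists_isBowenParameter (hT : IsTrapping p q c U ε R) (hp : 2 ≤ p)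
    (hq : q ≠ 0) :
    ∃ t : ℝ, IsBowenParameter p q c t ∧ dimH (juliaSet p q c) ≤ ENNReal.ofReal t := by
  obtain ⟨t, ht, hneg⟩ := hT.exists_zero hp hq
  refine ⟨t, ht, ?_⟩
  -- At `t` the pressure is zero, not negative, so the bound is obtained for `s > t` and passed to
  -- the limit.
  have hcont : Tendsto (fun s : ℝ ↦ ENNReal.ofReal s) (𝓝[>] t) (𝓝 (ENNReal.ofReal t)) :=
    (ENNReal.continuous_ofReal.tendsto t).mono_left nhdsWithin_le_nhds
  refine ge_of_tendsto hcont ?_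
  filter_upwards [self_mem_nhdsWithin] with s hs
  exact hT.dimH_le (by omega) hq (ht.1.trans hs) (hneg s hs)


/-! ### Escape and iterated preimages of a large disc. -/

theorem IsImage.norm_pow_eq {z w : ℂ} (h : IsImage p q c z w) : ‖w - c‖ ^ q = ‖z‖ ^ p := by
  rw [← norm_pow, ← norm_pow]
  exact congrArg norm h

/-- Points outside a large disc escape to infinity. -/
theorem IsImage.norm_add_one_le (hq : q ≠ 0) (hpq : q < p) (hR : 2 ^ q ≤ R) (hc : ‖c‖ + 1 ≤ R)
    {z w : ℂ} (h : IsImage p q c z w) (hz : R ≤ ‖z‖) : ‖z‖ + 1 ≤ ‖w‖ := by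
  have h1 : (1 : ℝ) ≤ ‖z‖ := (one_le_pow₀ one_le_two).trans (hR.trans hz)
  have h2 : (2 * ‖z‖) ^ q ≤ ‖w - c‖ ^ q := by
    rw [h.norm_pow_eq, mul_pow]
    calc 2 ^ q * ‖z‖ ^ q ≤ ‖z‖ * ‖z‖ ^ q := by
          gcongr
          exact hR.trans hz
      _ = ‖z‖ ^ (q + 1) := by ring
      _ ≤ ‖z‖ ^ p := pow_le_pow_right₀ h1 hpq
  have h3 := le_of_pow_le_pow_left₀ hq (norm_nonneg _) h2
  linarith [norm_sub_le w c]

/-- From a term of modulus at least `R` on, the moduli would grow by at least `1` per step. -/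
theorem norm_lt_of_isBounded (hq : q ≠ 0) (hpq : q < p) (hR : 2 ^ q ≤ R) (hc : ‖c‖ + 1 ≤ R)
    {x : ℕ → ℂ} (hx : IsOrbit p q c x) (hb : Bornology.IsBounded (Set.range x)) (i : ℕ) :
    ‖x i‖ < R := by
  by_contra! hi
  have hgrow : ∀ k : ℕ, ‖x i‖ + k ≤ ‖x (i + k)‖ := by
    intro k
    induction k with
    | zero => simp
    | succ k ih =>
      have hk : (0 : ℝ) ≤ k := Nat.cast_nonneg k
      have := (hx (i + k)).norm_add_one_le hq hpq hR hc (by linarith)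
      push_cast
      rw [← add_assoc]
      linarith!
  obtain ⟨C, hC⟩ := hb.exists_norm_le
  obtain ⟨k, hk⟩ := exists_nat_gt C
  have h1 := hgrow k
  have h2 := hC _ (Set.mem_range_self (i + k))
  linarith [norm_nonneg (x i)]

theorem isBounded_range_of_periodic {x : ℕ → ℂ} {n : ℕ} (hn : 0 < n)
    (h : Function.Periodic x n) : Bornology.IsBounded (Set.range x) := by
  refine ((Set.finite_Iio n).image x).isBounded.subset ?_
  rintro _ ⟨i, rfl⟩
  exact ⟨i % n, Nat.mod_lt _ hn, h.map_mod_nat i⟩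

theorem preimage_mono : Monotone (preimage p q c) := by
  rintro S T hST z ⟨w, hw, h⟩
  exact ⟨w, hST hw, h⟩

theorem mem_iterate_preimage_of_orbit {S : Set ℂ} {x : ℕ → ℂ} (hx : IsOrbit p q c x)
    (hS : ∀ i, x i ∈ S) (M i : ℕ) : x i ∈ (preimage p q c)^[M] S := by
  induction M generalizing i with
  | zero => exact hS i
  | succ M ih =>
    rw [Function.iterate_succ_apply']
    exact ⟨x (i + 1), ih (i + 1), hx i⟩

theorem preimage_closedBall_subset (hq : q ≠ 0) (hpq : q < p) (hR : 2 ^ q ≤ R)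
    (hc : ‖c‖ + 1 ≤ R) : preimage p q c (closedBall 0 R) ⊆ ball 0 R := by
  rintro z ⟨w, hw, h⟩
  rw [mem_ball_zero_iff]
  rw [mem_closedBall_zero_iff] at hw
  by_contra! hz
  linarith [h.norm_add_one_le hq hpq hR hc hz]

theorem iterate_preimage_closedBall_succ_subset (hq : q ≠ 0) (hpq : q < p) (hR : 2 ^ q ≤ R)
    (hc : ‖c‖ + 1 ≤ R) (M : ℕ) :
    (preimage p q c)^[M + 1] (closedBall 0 R) ⊆ (preimage p q c)^[M] (ball 0 R) := by
  rw [Function.iterate_succ_apply]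
  exact preimage_mono.iterate M (preimage_closedBall_subset hq hpq hR hc)

theorem antitone_iterate_preimage_closedBall (hq : q ≠ 0) (hpq : q < p) (hR : 2 ^ q ≤ R)
    (hc : ‖c‖ + 1 ≤ R) : Antitone fun M ↦ (preimage p q c)^[M] (closedBall 0 R) :=
  antitone_nat_of_succ_le fun M ↦ (iterate_preimage_closedBall_succ_subset hq hpq hR hc M).trans
    (preimage_mono.iterate M ball_subset_closedBall)

theorem iterate_preimage_closedBall_subset (hq : q ≠ 0) (hpq : q < p) (hR : 2 ^ q ≤ R)
    (hc : ‖c‖ + 1 ≤ R) (M : ℕ) : (preimage p q c)^[M] (closedBall 0 R) ⊆ closedBall 0 R :=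
  antitone_iterate_preimage_closedBall hq hpq hR hc (Nat.zero_le M)

/-- An image persists under perturbation: some `q`-th root of the perturbed `z ^ p` stays near `w -
c`. Openness is joint in the parameter so that membership extends to nearby `c`. -/
theorem isOpen_iterate_preimage (hq : q ≠ 0) (R : ℝ) (M : ℕ) :
    IsOpen {v : ℂ × ℂ | v.2 ∈ (preimage p q v.1)^[M] (ball 0 R)} := by
  induction M with
  | zero => exact isOpen_ball.preimage continuous_snd
  | succ M ih =>
    simp only [Function.iterate_succ_apply']
    rw [isOpen_iff_mem_nhds]
    rintro ⟨c, z⟩ ⟨w, hw, hzw⟩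
    have hzw : (w - c) ^ q = z ^ p := hzw
    obtain ⟨δ, hδ, hball⟩ := Metric.isOpen_iff.1 ih (c, w) hw
    have hcont : Continuous fun v : ℂ × ℂ ↦ ‖(w - c) ^ q - v.2 ^ p‖ := by fun_prop
    have hev : ∀ᶠ v : ℂ × ℂ in 𝓝 (c, z), ‖(w - c) ^ q - v.2 ^ p‖ < (δ / 2) ^ q := by
      refine hcont.continuousAt.eventually_lt continuousAt_const ?_
      simp [hzw, pow_pos (half_pos hδ)]
    have hev' : ∀ᶠ v : ℂ × ℂ in 𝓝 (c, z), dist v.1 c < δ / 2 :=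
      (continuous_fst.dist continuous_const).continuousAt.eventually_lt continuousAt_const
        (by simpa using half_pos hδ)
    filter_upwards [hev, hev'] with v hv hv'
    obtain ⟨u, hu, hwu⟩ := exists_pow_eq_norm_sub_pow_le hq (v.2 ^ p) (w - c)
    have hlt := lt_of_pow_lt_pow_left₀ q (half_pos hδ).le (hwu.trans_lt hv)
    suffices hmem : (v.1, v.1 + u) ∈ ball (c, w) δ from
      ⟨v.1 + u, hball hmem, by simpa [IsImage] using hu⟩
    rw [mem_ball, Prod.dist_eq, max_lt_iff]
    refine ⟨hv'.trans (half_lt_self hδ), ?_⟩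
    rw [dist_eq_norm] at hv' ⊢
    calc ‖v.1 + u - w‖ = ‖(v.1 - c) - (w - c - u)‖ := by congr 1; ring
      _ ≤ ‖v.1 - c‖ + ‖w - c - u‖ := norm_sub_le _ _
      _ < δ := by linarith

/-- The bound on the parameter confines the intermediate images to a fixed compact disc, over which
closed conditions project to closed ones. -/
theorem isClosed_iterate_preimage (hq : q ≠ 0) (hpq : q < p) (hR : 2 ^ q ≤ R) (M : ℕ) :
    IsClosed {v : ℂ × ℂ | ‖v.1‖ + 1 ≤ R ∧ v.2 ∈ (preimage p q v.1)^[M] (closedBall 0 R)} := by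
  have hcl : IsClosed {v : ℂ × ℂ | ‖v.1‖ + 1 ≤ R} := isClosed_le (by fun_prop) continuous_const
  induction M with
  | zero => exact hcl.inter (isClosed_closedBall.preimage continuous_snd)
  | succ M ih =>
    have h1 : IsClosed {y : (ℂ × ℂ) × ℂ | (‖y.1.1‖ + 1 ≤ R ∧
        y.2 ∈ (preimage p q y.1.1)^[M] (closedBall 0 R)) ∧ IsImage p q y.1.1 y.1.2 y.2} :=
      IsClosed.and (ih.preimage (f := fun y : (ℂ × ℂ) × ℂ ↦ (y.1.1, y.2)) (by fun_prop))
        (isClosed_eq (by fun_prop) (by fun_prop))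
    convert isClosed_exists_mem_of_isCompact (isCompact_closedBall (0 : ℂ) R) h1 using 1
    ext ⟨c, z⟩
    simp only [Function.iterate_succ_apply']
    constructor
    · rintro ⟨hc, w, hw, h⟩
      exact ⟨w, iterate_preimage_closedBall_subset hq hpq hR hc M hw, ⟨hc, hw⟩, h⟩
    · rintro ⟨w, -, ⟨hc, hw⟩, h⟩
      exact ⟨hc, w, hw, h⟩

theorem isClosed_iterate_preimage_closedBall (hq : q ≠ 0) (hpq : q < p) (hR : 2 ^ q ≤ R)
    (hc : ‖c‖ + 1 ≤ R) (M : ℕ) : IsClosed ((preimage p q c)^[M] (closedBall 0 R)) := by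
  have := (isClosed_iterate_preimage hq hpq hR M).preimage
    (f := fun z : ℂ ↦ (c, z)) (by fun_prop)
  simpa [hc] using this

/-- A point with arbitrarily long orbits in a disc has an infinite orbit there. -/
theorem exists_orbit_of_forall_mem (hq : q ≠ 0) (hpq : q < p) (hR : 2 ^ q ≤ R)
    (hc : ‖c‖ + 1 ≤ R) {z : ℂ} (hz : ∀ M, z ∈ (preimage p q c)^[M] (closedBall 0 R)) :
    ∃ x, IsOrbit p q c x ∧ x 0 = z ∧ Bornology.IsBounded (Set.range x) := by
  set F : ℕ → Set ℂ := fun M ↦ (preimage p q c)^[M] (closedBall 0 R) with hF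
  have hanti : Antitone F := antitone_iterate_preimage_closedBall hq hpq hR hc
  have hstep : ∀ z ∈ ⋂ M, F M, ∃ w ∈ ⋂ M, F M, IsImage p q c z w := by
    intro z hz
    have hcl : IsClosed {w | IsImage p q c z w} := isClosed_eq (by fun_prop) (by fun_prop)
    obtain ⟨w, hw⟩ := IsCompact.nonempty_iInter_of_sequence_nonempty_isCompact_isClosed
      (fun M ↦ {w | IsImage p q c z w} ∩ F M)
      (fun M ↦ Set.inter_subset_inter_right _ (hanti (Nat.le_succ M)))
      (fun M ↦ by
        have h := Set.mem_iInter.1 hz (M + 1)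
        simp only [hF, Function.iterate_succ_apply'] at h
        obtain ⟨w, hw, h⟩ := h
        exact ⟨w, h, hw⟩)
      ((isCompact_closedBall (0 : ℂ) R).inter_left hcl)
      (fun M ↦ hcl.inter (isClosed_iterate_preimage_closedBall hq hpq hR hc M))
    rw [Set.mem_iInter] at hw
    exact ⟨w, Set.mem_iInter.2 fun M ↦ (hw M).2, (hw 0).1⟩
  choose! g hgF hg using hstep
  have hmem : ∀ i, g^[i] z ∈ ⋂ M, F M := by
    intro i
    induction i with
    | zero => exact Set.mem_iInter.2 hz
    | succ i ih =>
      rw [Function.iterate_succ_apply']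
      exact hgF _ ih
  refine ⟨fun i ↦ g^[i] z, fun i ↦ ?_, rfl, (isBounded_closedBall (x := (0 : ℂ)) (r := R)).subset ?_⟩
  · simp only [Function.iterate_succ_apply']
    exact hg _ (hmem i)
  · rintro _ ⟨i, rfl⟩
    exact Set.mem_iInter.1 (hmem i) 0

theorem IsRepellingCycle.isOrbit_mod {n : ℕ} {z : ℕ → ℂ} (h : IsRepellingCycle p q c n z) :
    IsOrbit p q c fun i ↦ z (i % n) :=
  isImage_mod h.1 h.2.1 h.2.2.1

theorem isBounded_range_mod {n : ℕ} (hn : 0 < n) (z : ℕ → ℂ) :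
    Bornology.IsBounded (Set.range fun i ↦ z (i % n)) :=
  isBounded_range_of_periodic hn fun i ↦ by simp

/-! ### Construction of trapping domains. -/

/-- Construction of a trapping domain from an absorbing closed set `B`. -/
theorem exists_isTrapping (hq : q ≠ 0) (hpq : q < p) (hR : 2 ^ q ≤ R) (hc : ‖c‖ + 1 ≤ R)
    {B V : Set ℂ} {M : ℕ} (hB : IsClosed B) (hV : IsOpen V) (hVB : V ⊆ B)
    (habs : ∀ z ∈ B, ∀ w, IsImage p q c z w → w ∈ (preimage p q c)^[M] (closedBall 0 R) → w ∈ V)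
    (hcrit : c ∈ B ∨ c ∉ (preimage p q c)^[M] (ball 0 R))
    (hne : ((preimage p q c)^[M] (ball 0 R) \ B).Nonempty)
    (hcyc : ∀ n z, IsRepellingCycle p q c n z → ∀ i < n, z i ∉ B) :
    ∃ U ε R', IsTrapping p q c U ε R' := by
  set E := (preimage p q c)^[M] (ball 0 R) with hE
  set F := (preimage p q c)^[M] (closedBall 0 R) with hF
  have hRpos : 0 < R := by linarith [norm_nonneg c]
  have hEF : E ⊆ F := preimage_mono.iterate M ball_subset_closedBall
  have hFsub : F ⊆ closedBall 0 R := iterate_preimage_closedBall_subset hq hpq hR hc M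
  have hEopen : IsOpen E :=
    (isOpen_iterate_preimage hq R M).preimage (f := fun z : ℂ ↦ (c, z)) (by fun_prop)
  have hUopen : IsOpen (E \ B) := hEopen.sdiff hB
  have hFV : IsCompact (F \ V) := (isCompact_closedBall (0 : ℂ) R).of_isClosed_subset
    ((isClosed_iterate_preimage_closedBall hq hpq hR hc M).sdiff hV)
    (Set.sdiff_subset.trans hFsub)
  -- One more preimage turns the closed disc into the open one, and `habs` says that points of `B`
  -- have non-escaping images only in `V`. A compact set thus lies in an open one, which supplies
  -- `ε`.
  have hKsub : preimage p q c (F \ V) ⊆ E \ B := by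
    rintro z ⟨w, ⟨hwF, hwV⟩, h⟩
    refine ⟨?_, fun hzB ↦ hwV (habs z hzB w h hwF)⟩
    refine iterate_preimage_closedBall_succ_subset hq hpq hR hc M ?_
    rw [Function.iterate_succ_apply']
    exact ⟨w, hwF, h⟩
  have hK : IsCompact (preimage p q c (F \ V)) :=
    (isCompact_closedBall (0 : ℂ) R).of_isClosed_subset (isClosed_preimage hFV)
      ((hKsub.trans Set.sdiff_subset).trans (hEF.trans hFsub))
  obtain ⟨ε, hε, hthick⟩ := hK.exists_thickening_subset_open hUopen hKsub
  refine ⟨E \ B, ε, 2 * R, hUopen, hne, ?_, hε, by linarith, ?_, ?_, ?_⟩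
  · rintro ⟨h1, h2⟩
    exact hcrit.elim h2 fun h ↦ h h1
  · intro z hz w hw
    have h1 := mem_closedBall_zero_iff.1 (hFsub (hEF hz.1))
    have h2 := mem_closedBall_zero_iff.1 (hFsub (hEF hw.1))
    rw [dist_eq_norm]
    linarith [norm_sub_le z w]
  · intro z w h hw
    have hz : z ∈ preimage p q c (F \ V) := ⟨w, ⟨hEF hw.1, fun h ↦ hw.2 (hVB h)⟩, h⟩
    exact (ball_subset_thickening hz ε).trans hthick
  · intro n z hz i hi
    refine ⟨?_, hcyc n z hz i hi⟩
    have := mem_iterate_preimage_of_orbit hz.isOrbit_mod (S := ball 0 R) (fun j ↦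
      mem_ball_zero_iff.2 (norm_lt_of_isBounded hq hpq hR hc hz.isOrbit_mod
        (isBounded_range_mod hz.1 z) j)) M i
    simpa [Nat.mod_eq_of_lt hi] using this

theorem exists_isImage_self (hpq : q < p) (c : ℂ) : ∃ z, IsImage p q c z z := by
  obtain ⟨z, hz⟩ := Complex.exists_root (f := Polynomial.X ^ p -
    (Polynomial.X - Polynomial.C c) ^ q) (by
      have h1 : ((Polynomial.X - Polynomial.C c) ^ q).degree <
          (Polynomial.X ^ p : Polynomial ℂ).degree := by
        rw [Polynomial.degree_pow, Polynomial.degree_X_sub_C, Polynomial.degree_X_pow]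
        simpa using hpq
      rw [Polynomial.degree_sub_eq_left_of_degree_lt h1, Polynomial.degree_X_pow]
      exact_mod_cast (Nat.zero_le q).trans_lt hpq)
  refine ⟨z, ?_⟩
  simp only [Polynomial.IsRoot, Polynomial.eval_sub, Polynomial.eval_pow, Polynomial.eval_X,
    Polynomial.eval_C] at hz
  exact (sub_eq_zero.1 hz).symm

theorem mem_iterate_preimage_of_isImage_self (hq : q ≠ 0) (hpq : q < p) (hR : 2 ^ q ≤ R)
    (hc : ‖c‖ + 1 ≤ R) {z : ℂ} (hz : IsImage p q c z z) (M : ℕ) :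
    z ∈ (preimage p q c)^[M] (ball 0 R) := by
  have hx : IsOrbit p q c fun _ ↦ z := fun _ ↦ hz
  exact mem_iterate_preimage_of_orbit hx (fun i ↦ mem_ball_zero_iff.2
    (norm_lt_of_isBounded hq hpq hR hc hx (by simp) i)) M 0

/-- Parameters for which the critical point has no bounded orbit have a trapping domain. -/
theorem exists_isTrapping_of_notMem (hq : q ≠ 0) (hpq : q < p)
    (h : c ∉ boundedCriticalLocus p q) : ∃ U ε R, IsTrapping p q c U ε R := by
  have hp : p ≠ 0 := by omega
  set R : ℝ := max (2 ^ q) (‖c‖ + 1) with hRdef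
  have hR : 2 ^ q ≤ R := le_max_left _ _
  have hc : ‖c‖ + 1 ≤ R := le_max_right _ _
  obtain ⟨M, hM⟩ : ∃ M, c ∉ (preimage p q c)^[M] (closedBall 0 R) := by
    by_contra! hall
    obtain ⟨x, hx, hx0, hb⟩ := exists_orbit_of_forall_mem hq hpq hR hc hall
    refine h ⟨cons 0 x, ?_, rfl, ?_⟩
    · rintro (_ | i)
      · simp [IsImage, hx0, hq, hp]
      · exact hx i
    · refine (hb.union (Bornology.isBounded_singleton (x := (0 : ℂ)))).subset ?_
      rintro _ ⟨_ | i, rfl⟩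
      · exact Or.inr rfl
      · exact Or.inl ⟨i, rfl⟩
  obtain ⟨z, hz⟩ := exists_isImage_self hpq c
  exact exists_isTrapping hq hpq hR hc (B := ∅) (V := ∅) isClosed_empty isOpen_empty subset_rfl
    (by simp) (Or.inr fun h ↦ hM (preimage_mono.iterate M ball_subset_closedBall h))
    ⟨z, mem_iterate_preimage_of_isImage_self hq hpq hR hc hz M, Set.notMem_empty z⟩ (by simp)


/-! ### Discs around the critical cycle of a simple centre. -/

theorem IsImage.norm_branchDeriv_pow (hq : q ≠ 0) (hpq : q < p) {z w : ℂ} (hz : z ≠ 0)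
    (h : IsImage p q c z w) :
    ‖branchDeriv p q c z w‖ ^ q = (p / q : ℝ) ^ q * ‖z‖ ^ (p - q) := by
  have hz' : ‖z‖ ≠ 0 := norm_ne_zero_iff.2 hz
  have hq' : (q : ℝ) ≠ 0 := by exact_mod_cast hq
  rw [branchDeriv, norm_div, norm_mul, norm_mul, Complex.norm_natCast, Complex.norm_natCast,
    div_pow, mul_pow, mul_pow, h.norm_pow_eq, ← Nat.sub_add_cancel hpq.le, pow_add,
    Nat.add_sub_cancel, div_pow]
  field_simp

/-- The successor in the cyclic order of `1, …, n`. -/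
def cyclicSucc (n i : ℕ) : ℕ := if i = n then 1 else i + 1

theorem cyclicSucc_mem {n i : ℕ} (hi : i ∈ Set.Icc 1 n) : cyclicSucc n i ∈ Set.Icc 1 n := by
  unfold cyclicSucc
  obtain ⟨h1, h2⟩ := hi
  split_ifs with h
  · exact ⟨le_rfl, h1.trans h2⟩
  · exact ⟨by omega, by omega⟩

/-- A repelling cycle does not meet an absorbing cycle of discs on which the correspondence is
contracting. -/
theorem IsRepellingCycle.notMem_of_contracting (hq : q ≠ 0) (hpq : q < p) (hR : 2 ^ q ≤ R)
    (hc : ‖c‖ + 1 ≤ R) {n M : ℕ} {y : ℕ → ℂ} {ρ : ℕ → ℝ} {G : ℝ} (hn : 1 ≤ n) (hG : 1 ≤ G)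
    (hGR : (p / q : ℝ) ^ q * R ^ (p - q) ≤ G / 2)
    (hcon : ∀ z ∈ closedBall (y n) (ρ n), (p / q : ℝ) ^ q * ‖z‖ ^ (p - q) ≤ (G ^ (n - 1))⁻¹ / 2)
    (htr : ∀ i ∈ Set.Icc 1 n, ∀ z ∈ closedBall (y i) (ρ i), ∀ w, IsImage p q c z w →
      w ∈ (preimage p q c)^[M] (closedBall 0 R) →
        w ∈ ball (y (cyclicSucc n i)) (ρ (cyclicSucc n i)))
    {m : ℕ} {x : ℕ → ℂ} (hx : IsRepellingCycle p q c m x) {j : ℕ} (hj : j < m) :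
    x j ∉ ⋃ i ∈ Set.Icc 1 n, closedBall (y i) (ρ i) := by
  intro hjB
  have hG0 : 0 < G := zero_lt_one.trans_le hG
  set X : ℕ → ℂ := fun i ↦ x (i % m) with hX
  have hXorb : IsOrbit p q c X := hx.isOrbit_mod
  have hXR : ∀ i, ‖X i‖ < R := norm_lt_of_isBounded hq hpq hR hc hXorb
    (isBounded_range_mod hx.1 x)
  have hXF : ∀ i, X i ∈ (preimage p q c)^[M] (closedBall 0 R) := fun i ↦
    mem_iterate_preimage_of_orbit hXorb (fun i ↦ mem_closedBall_zero_iff.2 (hXR i).le) M i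
  have hX0 : ∀ i, X i ≠ 0 := fun i ↦ hx.2.2.2.2.1 _ (Nat.mod_lt _ hx.1)
  have hstep : ∀ l, ∀ i ∈ Set.Icc 1 n, X l ∈ closedBall (y i) (ρ i) →
      X (l + 1) ∈ closedBall (y (cyclicSucc n i)) (ρ (cyclicSucc n i)) := fun l i hi hl ↦
    ball_subset_closedBall (htr i hi _ hl _ (hXorb l) (hXF _))
  have hfrom : ∀ k, ∃ i ∈ Set.Icc 1 n, X (j + k) ∈ closedBall (y i) (ρ i) := by
    intro k
    induction k with
    | zero =>
      obtain ⟨i, hi, h⟩ := Set.mem_iUnion₂.1 hjB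
      exact ⟨i, hi, by simpa [hX, Nat.mod_eq_of_lt hj] using h⟩
    | succ k ih =>
      obtain ⟨i, hi, h⟩ := ih
      exact ⟨_, cyclicSucc_mem hi, hstep _ i hi h⟩
  obtain ⟨i₀, hi₀, h₀⟩ := hfrom (m - j)
  have hXm : X (j + (m - j)) = X 0 := by simp [hX, Nat.add_sub_cancel' hj.le]
  rw [hXm] at h₀
  have hder : ∀ l, ‖branchDeriv p q c (X l) (X (l + 1))‖ ^ q =
      (p / q : ℝ) ^ q * ‖X l‖ ^ (p - q) := fun l ↦
    (hXorb l).norm_branchDeriv_pow hq hpq (hX0 l)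
  -- The weight `G ^ i` records the position on the cycle of discs: an ordinary step costs at most
  -- `G / 2`, and the step from disc `n` repays `G ^ (n - 1)`. Every step therefore gains a factor
  -- `1 / 2`, which is incompatible with a multiplier above `1`.
  have hprod : ∀ l, ∃ i ∈ Set.Icc 1 n, X l ∈ closedBall (y i) (ρ i) ∧
      ∏ k ∈ Finset.range l, ‖branchDeriv p q c (X k) (X (k + 1))‖ ^ q ≤ (1 / 2) ^ l * G ^ i := by
    intro l
    induction l with
    | zero => exact ⟨i₀, hi₀, h₀, by simpa using one_le_pow₀ hG⟩
    | succ l ih =>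
      obtain ⟨i, hi, hl, hle⟩ := ih
      refine ⟨_, cyclicSucc_mem hi, hstep l i hi hl, ?_⟩
      rw [Finset.prod_range_succ, hder]
      unfold cyclicSucc
      split_ifs with h
      · subst h
        calc _ ≤ (1 / 2) ^ l * G ^ i * ((G ^ (i - 1))⁻¹ / 2) := by
              gcongr
              exact hcon _ hl
          _ = (1 / 2) ^ (l + 1) * G ^ 1 := by
              rw [← pow_sub_one_mul (by omega : i ≠ 0) G]
              field_simp
              ring
      · calc _ ≤ (1 / 2) ^ l * G ^ i * ((p / q : ℝ) ^ q * R ^ (p - q)) := by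
              gcongr
              exact (hXR l).le
          _ ≤ (1 / 2) ^ l * G ^ i * (G / 2) := by gcongr
          _ = (1 / 2) ^ (l + 1) * G ^ (i + 1) := by ring
  obtain ⟨k, hk⟩ := pow_unbounded_of_one_lt (G ^ n) (one_lt_two : (1 : ℝ) < 2)
  obtain ⟨i, hi, -, hle⟩ := hprod (k * m)
  have hP := hx.2.2.2.2.2
  rw [Finset.prod_pow, ← norm_prod, prod_branchDeriv_mod hx.2.2.1, norm_pow] at hle
  have h1 : (1 : ℝ) ≤
      (‖∏ i ∈ Finset.range m, branchDeriv p q c (x i) (x (i + 1))‖ ^ k) ^ q :=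
    one_le_pow₀ (one_le_pow₀ hP.le)
  have h2 : (1 / 2 : ℝ) ^ (k * m) * G ^ i ≤ (1 / 2) ^ k * G ^ n := by
    refine mul_le_mul ?_ (pow_le_pow_right₀ hG hi.2) (by positivity) (by positivity)
    exact pow_le_pow_of_le_one (by norm_num) (by norm_num) (Nat.le_mul_of_pos_right k hx.1)
  have h3 : (1 / 2 : ℝ) ^ k * G ^ n < (1 / 2) ^ k * 2 ^ k :=
    mul_lt_mul_of_pos_left hk (by positivity)
  rw [← mul_pow] at h3
  norm_num at h3
  norm_num at h1 h2 hle
  linarith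

/-- Non-escaping images depend in a Lipschitz way on the point and on the parameter. -/
theorem exists_lipschitz (hq : q ≠ 0) (hpq : q < p) (hR : 2 ^ q ≤ R) {a y y' : ℂ}
    (ha : ‖a‖ + 2 ≤ R) {M : ℕ} (hyy : IsImage p q a y y')
    (huniq : ∀ w, IsImage p q a y w → w ∈ (preimage p q a)^[M] (closedBall 0 R) → w = y') :
    ∃ L : ℝ, ∀ᶠ v : ℂ × ℂ in 𝓝 (a, y), ∀ w, IsImage p q v.1 v.2 w →
      w ∈ (preimage p q v.1)^[M] (closedBall 0 R) → ‖w - y'‖ ≤ L * ‖v.2 - y‖ + ‖v.1 - a‖ := by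
  have hp : p ≠ 0 := by omega
  have hyy : (y' - a) ^ q = y ^ p := hyy
  -- At the critical point `‖w - c‖ ^ q = ‖v‖ ^ p ≤ ‖v‖ ^ q` for `‖v‖ < 1`, as `q < p`; the
  -- branching does no harm.
  rcases eq_or_ne y 0 with rfl | hy
  · rw [zero_pow hp, pow_eq_zero_iff hq, sub_eq_zero] at hyy
    subst hyy
    have hev : ∀ᶠ v : ℂ × ℂ in 𝓝 (y', 0), ‖v.2‖ < 1 :=
      (continuous_snd.norm).continuousAt.eventually_lt continuousAt_const (by simp)
    refine ⟨1, ?_⟩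
    filter_upwards [hev] with v hv w hw _
    have h1 : ‖w - v.1‖ ^ q ≤ ‖v.2‖ ^ q := by
      rw [hw.norm_pow_eq]
      exact pow_le_pow_of_le_one (norm_nonneg _) hv.le hpq.le
    have h2 := le_of_pow_le_pow_left₀ hq (norm_nonneg _) h1
    rw [sub_zero, one_mul]
    linarith [norm_sub_le_norm_sub_add_norm_sub w v.1 y']
  set v₀ := y' - a with hv₀
  have hv₀ne : v₀ ≠ 0 := by
    intro h
    rw [h, zero_pow hq] at hyy
    exact pow_ne_zero p hy hyy.symm
  set S : ℕ → ℂ → ℂ → ℂ := fun n x y ↦ ∑ i ∈ Finset.range n, x ^ i * y ^ (n - 1 - i) with hS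
  have hSmul : ∀ n x y, S n x y * (x - y) = x ^ n - y ^ n := fun n x y ↦
    (Commute.all x y).geom_sum₂_mul n
  have hSdiag : S q v₀ v₀ ≠ 0 := by
    have h : S q v₀ v₀ = q * v₀ ^ (q - 1) := by
      simp only [hS]
      rw [Finset.sum_congr rfl (g := fun _ ↦ v₀ ^ (q - 1))]
      · simp
      · intro i hi
        have := Finset.mem_range.1 hi
        rw [← pow_add]
        congr 1
        omega
    rw [h]
    exact mul_ne_zero (by exact_mod_cast hq) (pow_ne_zero _ hv₀ne)
  set μ := ‖S q v₀ v₀‖ / 2 with hμ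
  have hμpos : 0 < μ := half_pos (norm_pos_iff.2 hSdiag)
  obtain ⟨ρ, hρ, hρS⟩ : ∃ ρ > 0, ∀ u, dist u v₀ < ρ → μ < ‖S q u v₀‖ := by
    have hcont : Continuous fun u ↦ ‖S q u v₀‖ := by fun_prop
    exact Metric.eventually_nhds_iff.1 (continuousAt_const.eventually_lt hcont.continuousAt
      (half_lt_self (norm_pos_iff.2 hSdiag)))
  -- Having a non-escaping image far from `y'` is a closed condition on parameter and point. It
  -- fails at `(a, y)` by uniqueness, hence also nearby.
  have hfar : IsClosed {v : ℂ × ℂ | ∃ w ∈ closedBall (0 : ℂ) R, (v, w) ∈ {b : (ℂ × ℂ) × ℂ |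
      ((‖b.1.1‖ + 1 ≤ R ∧ b.2 ∈ (preimage p q b.1.1)^[M] (closedBall 0 R)) ∧
        IsImage p q b.1.1 b.1.2 b.2) ∧ ρ / 2 ≤ ‖b.2 - y'‖}} := by
    refine isClosed_exists_mem_of_isCompact (isCompact_closedBall _ _)
      (IsClosed.and (IsClosed.and ?_ ?_) ?_)
    · exact (isClosed_iterate_preimage hq hpq hR M).preimage
        (f := fun b : (ℂ × ℂ) × ℂ ↦ (b.1.1, b.2)) (by fun_prop)
    · exact isClosed_eq (by fun_prop) (by fun_prop)
    · exact isClosed_le (by fun_prop) (by fun_prop)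
  have hnot : (a, y) ∉ {v : ℂ × ℂ | ∃ w ∈ closedBall (0 : ℂ) R, (v, w) ∈ {b : (ℂ × ℂ) × ℂ |
      ((‖b.1.1‖ + 1 ≤ R ∧ b.2 ∈ (preimage p q b.1.1)^[M] (closedBall 0 R)) ∧
        IsImage p q b.1.1 b.1.2 b.2) ∧ ρ / 2 ≤ ‖b.2 - y'‖}} := by
    rintro ⟨w, -, ⟨⟨-, hw⟩, him⟩, hge⟩
    have hge : ρ / 2 ≤ ‖w - y'‖ := hge
    rw [huniq w him hw, sub_self, norm_zero] at hge
    linarith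
  have hev1 := hfar.isOpen_compl.mem_nhds hnot
  have hev2 : ∀ᶠ v : ℂ × ℂ in 𝓝 (a, y), ‖v.1 - a‖ < min 1 (ρ / 2) := by
    have hcont : Continuous fun v : ℂ × ℂ ↦ ‖v.1 - a‖ := by fun_prop
    exact hcont.continuousAt.eventually_lt continuousAt_const (by simpa using hρ)
  set A := ‖S p y y‖ + 1 with hA
  have hev3 : ∀ᶠ v : ℂ × ℂ in 𝓝 (a, y), ‖S p v.2 y‖ < A := by
    have hcont : Continuous fun v : ℂ × ℂ ↦ ‖S p v.2 y‖ := by fun_prop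
    exact hcont.continuousAt.eventually_lt continuousAt_const (lt_add_one _)
  refine ⟨A / μ, ?_⟩
  filter_upwards [hev1, hev2, hev3] with v hv1 hv2 hv3 w hw hwF
  have hv2' := lt_min_iff.1 hv2
  have hcR : ‖v.1‖ + 1 ≤ R := by linarith [norm_le_norm_add_norm_sub' v.1 a]
  have hnear : ‖w - y'‖ < ρ / 2 := by
    by_contra! hge
    exact hv1 ⟨w, iterate_preimage_closedBall_subset hq hpq hR hcR M hwF, ⟨⟨hcR, hwF⟩, hw⟩, hge⟩
  have hw : (w - v.1) ^ q = v.2 ^ p := hw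
  have hu : dist (w - v.1) v₀ < ρ := by
    rw [dist_eq_norm, hv₀]
    calc ‖w - v.1 - (y' - a)‖ = ‖(w - y') - (v.1 - a)‖ := by congr 1; ring
      _ ≤ ‖w - y'‖ + ‖v.1 - a‖ := norm_sub_le _ _
      _ < ρ := by linarith
  have h1 : ‖S q (w - v.1) v₀‖ * ‖w - v.1 - v₀‖ = ‖S p v.2 y‖ * ‖v.2 - y‖ := by
    rw [← norm_mul, ← norm_mul, hSmul, hSmul, hw, hyy]
  have h2 : μ * ‖w - v.1 - v₀‖ ≤ A * ‖v.2 - y‖ := by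
    calc μ * ‖w - v.1 - v₀‖ ≤ ‖S q (w - v.1) v₀‖ * ‖w - v.1 - v₀‖ := by
          gcongr
          exact (hρS _ hu).le
      _ = ‖S p v.2 y‖ * ‖v.2 - y‖ := h1
      _ ≤ A * ‖v.2 - y‖ := by gcongr
  have h3 : ‖w - v.1 - v₀‖ ≤ A / μ * ‖v.2 - y‖ := by
    rw [div_mul_eq_mul_div, le_div_iff₀ hμpos]
    linarith
  calc ‖w - y'‖ = ‖(w - v.1 - v₀) + (v.1 - a)‖ := by rw [hv₀]; congr 1; ring
    _ ≤ ‖w - v.1 - v₀‖ + ‖v.1 - a‖ := norm_add_le _ _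
    _ ≤ _ := by gcongr

theorem finite_setOf_isImage (hq : q ≠ 0) (c z : ℂ) : {w | IsImage p q c z w}.Finite := by
  refine ((Polynomial.nthRoots q (z ^ p)).toFinset.finite_toSet.image fun u ↦ u + c).subset ?_
  intro w hw
  refine ⟨w - c, ?_, by ring⟩
  rw [Finset.mem_coe, Multiset.mem_toFinset, Polynomial.mem_nthRoots (Nat.pos_of_ne_zero hq)]
  exact hw

/-- Following `z` up to time `i` and then `x`. -/
theorem IsOrbit.append {z x : ℕ → ℂ} (hz : IsOrbit p q c z) (hx : IsOrbit p q c x) {i : ℕ}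
    (h : IsImage p q c (z i) (x 0)) :
    IsOrbit p q c fun j ↦ if j ≤ i then z j else x (j - (i + 1)) := by
  intro j
  rcases lt_trichotomy j i with hj | rfl | hj
  · simpa [hj.le, Nat.succ_le_of_lt hj] using hz j
  · simpa using h
  · have h1 : ¬ j ≤ i := by omega
    have h2 : ¬ j + 1 ≤ i := by omega
    have h3 : j + 1 - (i + 1) = j - (i + 1) + 1 := by omega
    simp only [h1, h2, if_false, h3]
    exact hx _

theorem not_tendsto_cobounded_of_isBounded {x : ℕ → ℂ}
    (hb : Bornology.IsBounded (Set.range x)) : ¬ Tendsto x atTop (Bornology.cobounded ℂ) := by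
  intro h
  obtain ⟨C, hC⟩ := hb.exists_norm_le
  obtain ⟨i, hi⟩ := ((tendsto_norm_atTop_iff_cobounded.2 h).eventually_gt_atTop C).exists
  exact hi.not_ge (hC _ (Set.mem_range_self i))

/-- Parameters near a simple centre have a trapping domain. -/
theorem IsSimpleCentre.eventually_exists_isTrapping (hq : q ≠ 0) (hpq : q < p) {a : ℂ}
    (ha : IsSimpleCentre p q a) : ∀ᶠ c in 𝓝 a, ∃ U ε R, IsTrapping p q c U ε R := by
  obtain ⟨z, hz, hz0, ⟨n, hn, hper⟩, hesc⟩ := ha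
  have hp : p ≠ 0 := by omega
  set R : ℝ := 2 ^ q + ‖a‖ + 2 with hRdef
  have hR : 2 ^ q ≤ R := by linarith [norm_nonneg a]
  have haR : ‖a‖ + 2 ≤ R := by
    have : (0 : ℝ) < 2 ^ q := by positivity
    linarith
  have haR' : ‖a‖ + 1 ≤ R := by linarith
  have hzb : Bornology.IsBounded (Set.range z) := isBounded_range_of_periodic hn hper
  have huniq : ∀ w, IsOrbit p q a w → w 0 = 0 → Bornology.IsBounded (Set.range w) → w = z := by
    intro w hw hw0 hwb
    by_contra hne
    exact not_tendsto_cobounded_of_isBounded hwb (hesc w hw hw0 hne)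
  -- Prefixing `x` by `z` up to time `i` gives a bounded orbit of `0`, which must be `z`.
  have hjoin : ∀ (i : ℕ) (x : ℕ → ℂ), IsOrbit p q a x → IsImage p q a (z i) (x 0) →
      Bornology.IsBounded (Set.range x) → ∀ j, x j = z (i + 1 + j) := by
    intro i x hx him hxb j
    have h := huniq _ (hz.append hx him) (by simpa using hz0) ((hzb.union hxb).subset (by
      rintro _ ⟨j, rfl⟩
      by_cases hj : j ≤ i
      · exact Or.inl ⟨j, by simp [hj]⟩
      · exact Or.inr ⟨j - (i + 1), by simp [hj]⟩))
    have hj := congrFun h (i + 1 + j)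
    have hnot : ¬ i + 1 + j ≤ i := by omega
    simpa [hnot] using hj
  have hzn : z n = 0 := by simpa [hz0] using hper 0
  have hz1 : z 1 = a := by
    have h := hz 0
    rw [hz0, IsImage, zero_pow hp, pow_eq_zero_iff hq, sub_eq_zero] at h
    exact h
  -- Each point of the cycle has finitely many images, and all but the next cycle point leave the
  -- nested preimages, so one `M` serves for all.
  obtain ⟨M, hM⟩ : ∃ M, ∀ i ∈ Set.Icc 1 n, ∀ w, IsImage p q a (z i) w →
      w ∈ (preimage p q a)^[M] (closedBall 0 R) → w = z (i + 1) := by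
    have hev : ∀ᶠ M in atTop, ∀ i ∈ Set.Icc 1 n, ∀ w ∈ {w | IsImage p q a (z i) w},
        w ∈ (preimage p q a)^[M] (closedBall 0 R) → w = z (i + 1) := by
      refine (eventually_all_finite (Set.finite_Icc 1 n)).2 fun i _ ↦
        (eventually_all_finite (finite_setOf_isImage hq a (z i))).2 fun w hw ↦ ?_
      by_cases hwz : w = z (i + 1)
      · exact Eventually.of_forall fun _ _ ↦ hwz
      obtain ⟨M₀, hM₀⟩ : ∃ M, w ∉ (preimage p q a)^[M] (closedBall 0 R) := by
        by_contra! hall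
        obtain ⟨x, hx, hx0, hxb⟩ := exists_orbit_of_forall_mem hq hpq hR haR' hall
        have h := hjoin i x hx (by rw [hx0]; exact hw) hxb 0
        exact hwz (hx0.symm.trans h)
      filter_upwards [eventually_ge_atTop M₀] with M hMM hw
      exact absurd (antitone_iterate_preimage_closedBall hq hpq hR haR' hMM hw) hM₀
    exact hev.exists
  have hlip : ∀ i ∈ Set.Icc 1 n, ∃ L : ℝ, ∀ᶠ v : ℂ × ℂ in 𝓝 (a, z i), ∀ w,
      IsImage p q v.1 v.2 w → w ∈ (preimage p q v.1)^[M] (closedBall 0 R) →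
        ‖w - z (i + 1)‖ ≤ L * ‖v.2 - z i‖ + ‖v.1 - a‖ := fun i hi ↦
    exists_lipschitz hq hpq hR haR (hz i) (hM i hi)
  choose! L hL using hlip
  obtain ⟨L₀, hL₀⟩ := ((Set.finite_Icc 1 n).image L).bddAbove
  set Λ := max L₀ 1 with hΛ
  have hLΛ : ∀ i ∈ Set.Icc 1 n, L i ≤ Λ := fun i hi ↦
    (hL₀ ⟨i, hi, rfl⟩).trans (le_max_left _ _)
  have hΛ1 : 1 ≤ Λ := le_max_right _ _
  have hΛ0 : 0 < Λ := zero_lt_one.trans_le hΛ1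
  obtain ⟨s, hs, hs0⟩ : ∃ s, IsImage p q a s s ∧ s ≠ 0 := by
    rcases eq_or_ne a 0 with rfl | ha0
    · exact ⟨1, by simp [IsImage], one_ne_zero⟩
    · obtain ⟨s, hs⟩ := exists_isImage_self hpq a
      refine ⟨s, hs, ?_⟩
      rintro rfl
      rw [IsImage, zero_pow hp, pow_eq_zero_iff hq, zero_sub, neg_eq_zero] at hs
      exact ha0 hs
  have hsz : ∀ i, s ≠ z i := by
    intro i hsi
    have h := hjoin i (fun _ ↦ s) (fun _ ↦ hs) (by rw [← hsi]; exact hs) (by simp)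
      -- The index is chosen so that `z` is evaluated at `(i + 1) * n`, where it is `0`.
      (i * (n - 1) + n - 1)
    have hidx : i + 1 + (i * (n - 1) + n - 1) = (i + 1) * n := by
      obtain ⟨k, rfl⟩ : ∃ k, n = k + 1 := ⟨n - 1, by omega⟩
      simp only [Nat.add_sub_cancel]
      rw [show i * k + (k + 1) - 1 = i * k + k by omega]
      ring
    have hzero : z ((i + 1) * n) = 0 := by
      have := hper.nat_mul (i + 1) 0
      simpa [hz0] using this
    rw [hidx, hzero] at h
    exact hs0 h
  set G : ℝ := max 1 (2 * ((p / q : ℝ) ^ q * R ^ (p - q))) with hG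
  have hG1 : 1 ≤ G := le_max_left _ _
  have hGR : (p / q : ℝ) ^ q * R ^ (p - q) ≤ G / 2 := by
    linarith [le_max_right 1 (2 * ((p / q : ℝ) ^ q * R ^ (p - q)))]
  have hG0 : 0 < G := zero_lt_one.trans_le hG1
  have hβ : (0 : ℝ) < (p / q : ℝ) ^ q := by
    have h1 : (0 : ℝ) < p := by exact_mod_cast Nat.pos_of_ne_zero hp
    have h2 : (0 : ℝ) < q := by exact_mod_cast Nat.pos_of_ne_zero hq
    positivity
  -- Below, `r ≤ τ ^ q` gives `r ^ p ≤ (r * τ) ^ q`, so images of the disc around `0` lie within `r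
  -- * τ = ρ 1 / 2` of `c`.
  set τ : ℝ := ((2 * Λ) ^ (n - 1))⁻¹ / 2 with hτ
  have hτ0 : 0 < τ := by positivity
  have hsmall : ∀ κ : ℝ, 0 < κ → ∀ᶠ r in 𝓝[>] (0 : ℝ), r ≤ κ := fun κ hκ ↦ by
    filter_upwards [Ioc_mem_nhdsGT hκ] with r hr using hr.2
  have hev1 : ∀ᶠ r in 𝓝[>] (0 : ℝ), ∀ i ∈ Set.Icc 1 n, ∀ v ∈ closedBall ((a, z i) : ℂ × ℂ) r, ∀ w,
      IsImage p q v.1 v.2 w → w ∈ (preimage p q v.1)^[M] (closedBall 0 R) →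
        ‖w - z (i + 1)‖ ≤ L i * ‖v.2 - z i‖ + ‖v.1 - a‖ := by
    refine (eventually_all_finite (Set.finite_Icc 1 n)).2 fun i hi ↦ ?_
    exact (eventually_closedBall_subset (hL i hi)).filter_mono nhdsWithin_le_nhds
  have hev2 : ∀ᶠ r in 𝓝[>] (0 : ℝ), ∀ i ∈ Set.Icc 1 n, r ≤ dist s (z i) / 2 :=
    (eventually_all_finite (Set.finite_Icc 1 n)).2 fun i _ ↦
      hsmall _ (half_pos (dist_pos.2 (hsz i)))
  obtain ⟨r, hrlip, hrs, hr1, hrτ, hrG, hr0⟩ := (hev1.and (hev2.and ((hsmall 1 one_pos).and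
    ((hsmall (τ ^ q) (by positivity)).and
      ((hsmall ((G ^ (n - 1))⁻¹ / 2 / (p / q : ℝ) ^ q) (by positivity)).and
        (self_mem_nhdsWithin : Set.Ioi (0 : ℝ) ∈ 𝓝[>] 0)))))).exists
  have hr0 : 0 < r := hr0
  -- The radii grow by `2 * Λ` along the cycle up to `ρ n = r`. The Lipschitz bound then uses half
  -- of the next radius, and the other half absorbs `‖c - a‖ < ρ 1 / 2`.
  set ρ : ℕ → ℝ := fun i ↦ r * ((2 * Λ) ^ (n - i))⁻¹ with hρ
  have hρpos : ∀ i, 0 < ρ i := fun i ↦ by positivity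
  have hρle : ∀ i, ρ i ≤ r := fun i ↦
    mul_le_of_le_one_right hr0.le (inv_le_one_of_one_le₀ (one_le_pow₀ (by linarith)))
  have hρ1 : ∀ i ∈ Set.Icc 1 n, ρ 1 ≤ ρ i := by
    intro i hi
    simp only [hρ]
    gcongr
    · linarith
    · exact hi.1
  have hρn : ρ n = r := by simp [hρ]
  have hρsucc : ∀ i < n, Λ * ρ i = ρ (i + 1) / 2 := by
    intro i hi
    simp only [hρ]
    rw [show n - i = n - (i + 1) + 1 by omega, pow_succ]
    field_simp
  have hτρ : r * τ = ρ 1 / 2 := by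
    simp only [hρ, hτ]
    ring
  have hopen := (isOpen_iterate_preimage (p := p) hq R M).preimage
    (f := fun c : ℂ ↦ (c, s)) (by fun_prop)
  have hsmem : a ∈ (fun c : ℂ ↦ (c, s)) ⁻¹' {v : ℂ × ℂ | v.2 ∈ (preimage p q v.1)^[M] (ball 0 R)} :=
    mem_iterate_preimage_of_isImage_self hq hpq hR haR' hs M
  filter_upwards [ball_mem_nhds a (half_pos (hρpos 1)), hopen.mem_nhds hsmem] with c hca hcs
  rw [mem_ball, dist_eq_norm] at hca
  have hcR : ‖c‖ + 1 ≤ R := by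
    have := hρle 1
    linarith [norm_le_norm_add_norm_sub' c a]
  have htr : ∀ i ∈ Set.Icc 1 n, ∀ u ∈ closedBall (z i) (ρ i), ∀ w, IsImage p q c u w →
      w ∈ (preimage p q c)^[M] (closedBall 0 R) →
        w ∈ ball (z (cyclicSucc n i)) (ρ (cyclicSucc n i)) := by
    intro i hi u hu w hw hwF
    rw [mem_closedBall, dist_eq_norm] at hu
    rw [mem_ball, dist_eq_norm]
    unfold cyclicSucc
    split_ifs with h
    · subst h
      rw [hzn, sub_zero, hρn] at hu
      have h1 : ‖w - c‖ ^ q ≤ (r * τ) ^ q := by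
        rw [hw.norm_pow_eq]
        calc ‖u‖ ^ p ≤ r ^ p := by gcongr
          _ ≤ r ^ (q + 1) := pow_le_pow_of_le_one hr0.le hr1 hpq
          _ = r ^ q * r := pow_succ _ _
          _ ≤ r ^ q * τ ^ q := by gcongr
          _ = (r * τ) ^ q := (mul_pow _ _ _).symm
      have h2 := le_of_pow_le_pow_left₀ hq (by positivity) h1
      rw [hz1]
      linarith [norm_sub_le_norm_sub_add_norm_sub w c a]
    · have hin : i < n := lt_of_le_of_ne hi.2 h
      have h1 := hrlip i hi (c, u) (by
        rw [mem_closedBall, Prod.dist_eq, max_le_iff, dist_eq_norm, dist_eq_norm]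
        have := hρle 1
        exact ⟨by linarith, hu.trans (hρle i)⟩) w hw hwF
      have h2 : L i * ‖u - z i‖ ≤ Λ * ρ i :=
        mul_le_mul (hLΛ i hi) hu (norm_nonneg _) hΛ0.le
      have h3 := hρ1 (i + 1) ⟨by omega, hin⟩
      have h4 := hρsucc i hin
      simp only at h1
      linarith
  refine exists_isTrapping hq hpq hR hcR (M := M)
    (B := ⋃ i ∈ Set.Icc 1 n, closedBall (z i) (ρ i)) (V := ⋃ i ∈ Set.Icc 1 n, ball (z i) (ρ i))
    ((Set.finite_Icc 1 n).isClosed_biUnion fun i _ ↦ isClosed_closedBall)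
    (isOpen_biUnion fun i _ ↦ isOpen_ball)
    (Set.iUnion₂_mono fun i _ ↦ ball_subset_closedBall) ?_ (Or.inl ?_) ⟨s, hcs, ?_⟩ ?_
  · intro u hu w hw hwF
    obtain ⟨i, hi, hu⟩ := Set.mem_iUnion₂.1 hu
    exact Set.mem_iUnion₂.2 ⟨_, cyclicSucc_mem hi, htr i hi u hu w hw hwF⟩
  · refine Set.mem_iUnion₂.2 ⟨1, ⟨le_rfl, hn⟩, ?_⟩
    rw [hz1, mem_closedBall, dist_eq_norm]
    linarith [hρpos 1]
  · intro hsB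
    obtain ⟨i, hi, hsi⟩ := Set.mem_iUnion₂.1 hsB
    have h1 := hrs i hi
    have h2 := mem_closedBall.1 hsi
    have h3 := hρle i
    linarith [dist_pos.2 (hsz i)]
  · intro m x hx j hj
    refine hx.notMem_of_contracting hq hpq hR hcR hn hG1 hGR ?_ htr hj
    intro u hu
    rw [hzn, hρn, mem_closedBall_zero_iff] at hu
    rw [le_div_iff₀ hβ] at hrG
    have h1 : ‖u‖ ^ (p - q) ≤ r := by
      calc ‖u‖ ^ (p - q) ≤ ‖u‖ ^ 1 :=
            pow_le_pow_of_le_one (norm_nonneg _) (hu.trans hr1) (by omega)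
        _ ≤ r := by rwa [pow_one]
    calc (p / q : ℝ) ^ q * ‖u‖ ^ (p - q) ≤ (p / q : ℝ) ^ q * r := by gcongr
      _ ≤ _ := by linarith

end Correspondence

theorem mainTheorem3 (p q : ℕ) (hq : 2 ≤ q) (hpq : q < p) :
    (∀ a : ℂ, Correspondence.IsSimpleCentre p q a →
      ∀ᶠ c in 𝓝 a, ∃ t : ℝ, Correspondence.IsBowenParameter p q c t ∧
        dimH (Correspondence.juliaSet p q c) ≤ ENNReal.ofReal t) ∧
    (∀ c : ℂ, (∀ z : ℕ → ℂ, Correspondence.IsOrbit p q c z → z 0 = 0 →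
        Tendsto z atTop (Bornology.cobounded ℂ)) →
      ∃ t : ℝ, Correspondence.IsBowenParameter p q c t ∧
        dimH (Correspondence.juliaSet p q c) ≤ ENNReal.ofReal t) ∧
    (∀ c : ℂ, c ∉ Correspondence.boundedCriticalLocus p q →
      ∃ t : ℝ, Correspondence.IsBowenParameter p q c t ∧
        dimH (Correspondence.juliaSet p q c) ≤ ENNReal.ofReal t) := by
  have hq0 : q ≠ 0 := by omega
  have hp2 : 2 ≤ p := by omega
  have hbounded : ∀ c : ℂ, c ∉ Correspondence.boundedCriticalLocus p q →
      ∃ t : ℝ, Correspondence.IsBowenParameter p q c t ∧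
        dimH (Correspondence.juliaSet p q c) ≤ ENNReal.ofReal t := by
    intro c hc
    obtain ⟨U, ε, R, hT⟩ := Correspondence.exists_isTrapping_of_notMem hq0 hpq hc
    exact hT.exists_isBowenParameter hp2 hq0
  refine ⟨fun a ha ↦ ?_, fun c hc ↦ hbounded c ?_, hbounded⟩
  · filter_upwards [ha.eventually_exists_isTrapping hq0 hpq] with c hT
    obtain ⟨U, ε, R, hT⟩ := hT
    exact hT.exists_isBowenParameter hp2 hq0
  · rintro ⟨z, hz, hz0, hzb⟩
    exact Correspondence.not_tendsto_cobounded_of_isBounded hzb (hc z hz hz0)
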